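/- Let $\mathcal Y\subseteq\mathbb R$ be a Borel set and let $f$ be a probability density on $\mathbb R$ carried by $\mathcal Y$. Let $K$ be a symmetric probability density on $\mathbb R$ with mean $0$ and finite variance, and write $R(g)=\int g(u)^2\,du$, $\mu_2=\int u^2K(u)\,du$, $K_h(u)=h^{-1}K(u/h)$. Assume that $R(K)<\infty$ and that for $r=1,2,3$: $|t|^{r+1}K(t)\to0$ as $|t|\to\infty$, $\int|t|^rK(t)\,dt<\infty$, and $f^{(r)}$ exists, is continuous and is in $L^1(\mathbb R)$. Let $Y_1,Y_2,\dots$ be a Markov chain on $\mathcal Y$ with transition kernel $P$ and initial distribution $f$. Suppose that the chain is geometrically ergodic, i.e. there are $\rho\in[0,1)$ and $M:\mathcal Y\to\mathbb R$ such that $\sup_A|P^n(y,A)-\int_A f|\le M(y)\rho^n$ for all $y\in\mathcal Y$ and $n\ge0$ (supremum over the measurable $A\subseteq\mathcal Y$), and that $P$ satisfies detailed balance with respect to $f$: $f(dy)P(y,dy')=f(dy')P(y',dy)$. Put $$\hat f_h(x)=\frac1{nh}\sum_{i=1}^nK\Big(\frac{x-Y_i}h\Big),\qquad \mathrm{MISE}(h)=\int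 E\{\hat f_h(x)-f(x)\}^2\,dx,$$ $$\tau_n(K_{h,x})=\sum_{t=-(n-1)}^{n-1}\Big(1-\frac{|t|}n\Big)\mathrm{corr}\{K_h(x-Y_1),K_h(x-Y_{|t|+1})\},\qquad \zeta_f(K_h)=\int\tau_n(K_{h,x})f(x)\,dx,$$ $$\mathrm{mAMISE}(h)=\frac1{nh}R(K)\,\zeta_f(K_h)+\frac{h^4}4\mu_2^2R(f''),$$ where a correlation is taken to be $0$ if one of the variances vanishes. Then for all $n\ge1$ and $h>0$ the integrals in $\mathrm{MISE}(h)$ and $\mathrm{mAMISE}(h)$ converge (the one in $\zeta_f(K_h)$ absolutely), and for every sequence of bandwidths $h=h(n)>0$ with $h(n)\to0$, $$\mathrm{MISE}(h)=\mathrm{mAMISE}(h)+O(n^{-1}+h^5)\qquad\text{as }n\to\infty.$$ -/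

import Mathlib

open MeasureTheory ProbabilityTheory Filter Topology Asymptotics

noncomputable section

namespace MarkovKDE

/-- A symmetric (Borel) probability density with mean zero and finite variance. -/
structure IsSymmetricDensity (K : ℝ → ℝ) : Prop where
  measurable : Measurable K
  nonneg : ∀ t, 0 ≤ K t
  symm : ∀ t, K (-t) = K t
  integrable : Integrable K
  integral_eq_one : ∫ t, K t = 1
  mean_zero : ∫ t, t * K t = 0
  finite_variance : Integrable (fun t => t ^ 2 * K t)

/-- The standing conditions on the smoothing kernel `K` and the density `f`, at the order `r`. -/
structure RegularityConditions (K f : ℝ → ℝ) (r : ℕ) : Prop where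
  tail : Tendsto (fun t => |t| ^ (r + 1) * K t) (cocompact ℝ) (𝓝 0)
  moment : Integrable (fun t => |t| ^ r * K t)
  /-- `f` has an `r`-th derivative, and this derivative is continuous. -/
  contDiff : ContDiff ℝ r f
  integrable_deriv : Integrable (iteratedDeriv r f)
  kernel : IsSymmetricDensity K

/-- `f` is a probability density on the line, carried by the state space `S`. -/
structure IsDensityOn (f : ℝ → ℝ) (S : Set ℝ) : Prop where
  nonneg : ∀ x, 0 ≤ f x
  integrable : Integrable f
  integral_eq_one : ∫ x, f x = 1
  ae_zero_off : ∀ᵐ x, x ∉ S → f x = 0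

/-- The distribution with density `f`, as a measure on the state space `S`. -/
def densityMeasure (f : ℝ → ℝ) (S : Set ℝ) : Measure S :=
  (volume.withDensity (fun x => ENNReal.ofReal (f x))).comap Subtype.val

section Chains

variable {E : Type*} [MeasurableSpace E]

/-- The `n`-step transition kernel of `P`. -/
def stepKernel (P : Kernel E E) : ℕ → Kernel E E
  | 0 => Kernel.id
  | n + 1 => P ∘ₖ stepKernel P n

/-- Total variation distance of two probability measures, `sup_A |μ A - ν A|`. -/
def tvDist (μ ν : Measure E) : ℝ :=
  ⨆ A : {A : Set E // MeasurableSet A}, |μ.real A - ν.real A|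

/-- Geometric ergodicity: from every starting point `y`, the law of the chain after `n` steps
converges to `π` in total variation, at a geometric rate with a finite constant `M y`.
(Invariance of `π`, irreducibility, aperiodicity and Harris recurrence follow from this.) -/
def GeometricallyErgodic (P : Kernel E E) (π : Measure E) : Prop :=
  ∃ (M : E → ℝ) (ρ : ℝ), 0 ≤ ρ ∧ ρ < 1 ∧ ∀ (y : E) (n : ℕ), tvDist (stepKernel P n y) π ≤ M y * ρ ^ n

/-- `Y 0, Y 1, …` is a time-homogeneous Markov chain with transition kernel `P` and initial
distribution `π`: given the past `Y 0, …, Y n`, the next state has law `P (Y n)`. -/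
structure IsMarkovChain {Ω : Type*} [MeasurableSpace Ω] (μ : Measure Ω) (Y : ℕ → Ω → E)
    (P : Kernel E E) (π : Measure E) : Prop where
  measurable : ∀ i, Measurable (Y i)
  initial : μ.map (Y 0) = π
  markov : ∀ (n : ℕ) (A : Set E), MeasurableSet A →
    μ[(Y (n + 1) ⁻¹' A).indicator (fun _ => (1 : ℝ)) |
        ⨆ i : Fin (n + 1), MeasurableSpace.comap (Y i) inferInstance]
      =ᵐ[μ] fun ω => (P (Y n ω)).real A

end Chains

/-- The squared `L²` norm `R(g)`. -/
def R (g : ℝ → ℝ) : ℝ := ∫ u, g u ^ 2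

/-- The second moment of the kernel. -/
def secondMoment (K : ℝ → ℝ) : ℝ := ∫ u, u ^ 2 * K u

/-- The rescaled kernel `K_h(u) = K(u/h)/h`. -/
def scaled (K : ℝ → ℝ) (h u : ℝ) : ℝ := K (u / h) / h

section Estimator

variable {Ω : Type*} [MeasurableSpace Ω]

/-- Correlation of two real random variables. -/
def corr (μ : Measure Ω) (U V : Ω → ℝ) : ℝ :=
  covariance U V μ / (√(variance U μ) * √(variance V μ))

/-- The kernel density estimator at `x` from the sample `Y 0, …, Y (n - 1)` with bandwidth `h`. -/
def kde (K : ℝ → ℝ) (Y : ℕ → Ω → ℝ) (n : ℕ) (h x : ℝ) (ω : Ω) : ℝ :=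
  1 / (n * h) * ∑ i ∈ Finset.range n, K ((x - Y i ω) / h)

/-- Mean integrated squared error. -/
def mise (μ : Measure Ω) (K f : ℝ → ℝ) (Y : ℕ → Ω → ℝ) (n : ℕ) (h : ℝ) : ℝ :=
  ∫ x, ∫ ω, (kde K Y n h x ω - f x) ^ 2 ∂μ

/-- Integrated autocorrelation time of the kernel at `x`: the sum over the lags `|t| < n`. The
sample is stationary, so that the correlation at the lag `t` is the one at the lag `|t|`. -/
def tau (μ : Measure Ω) (K : ℝ → ℝ) (Y : ℕ → Ω → ℝ) (n : ℕ) (h x : ℝ) : ℝ :=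
  ∑ t ∈ Finset.Ioo (-(n : ℤ)) n, (1 - |(t : ℝ)| / n) *
    corr μ (fun ω => scaled K h (x - Y 0 ω)) (fun ω => scaled K h (x - Y t.natAbs ω))

/-- The average `ζ_f(K_h)` of the integrated autocorrelation time with respect to `f`. -/
def zeta (μ : Measure Ω) (K f : ℝ → ℝ) (Y : ℕ → Ω → ℝ) (n : ℕ) (h : ℝ) : ℝ :=
  ∫ x, tau μ K Y n h x * f x

/-- The modified asymptotic mean integrated squared error. -/
def mamise (μ : Measure Ω) (K f : ℝ → ℝ) (Y : ℕ → Ω → ℝ) (n : ℕ) (h : ℝ) : ℝ :=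
  1 / (n * h) * R K * zeta μ K f Y n h
    + h ^ 4 / 4 * secondMoment K ^ 2 * R (iteratedDeriv 2 f)

end Estimator

end MarkovKDE

end

/-! The mean squared error at `x` is variance plus squared bias, and stationarity makes the variance
exactly `n⁻¹ · Var K_h(x - Y₁) · τ_n(x)`. Two deterministic estimates in `L¹(dx)` then suffice.
First, `Var K_h(x - Y₁) = h⁻¹ R(K) f(x) + A(x)` with `∫ |A|` bounded uniformly in `h`
(`integral_abs_variance_remainder_le`). Second, the squared bias is `h⁴/4 · μ₂² f''(x)²` up to
`O(h⁵)` in `L¹` (`integral_abs_sq_bias_sub_le`). The main terms integrate exactly to mAMISE, leaving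
`n⁻¹ ∫ τ_n A + O(h⁵)`.

To make `n⁻¹ ∫ τ_n A` an `O(n⁻¹)`, `τ_n(x)` must be bounded uniformly in `n`, `h` and `x`. This is
the probabilistic core, `GeometricallyErgodic.abs_autocovariance_le`: a reversible geometrically
ergodic chain has a spectral gap, so every lag-`t` correlation is at most `ρ ^ t` in absolute value,
with one `ρ < 1` for all square integrable functions.

Ergodicity alone gives `|γ_t| ≤ C ρ ^ t` with `C` depending on the function, and only for functions
living where `M` is bounded. Reversibility removes `C`: `P` is self-adjoint, so `γ_{2t} = ‖P^t u‖²`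
and Cauchy–Schwarz gives `γ_t² ≤ γ_0 γ_{2t}`. Iterating along `t, 2t, 4t, …` forces `|γ_t| ≤ ρ ^ t
γ_0`. This bound no longer depends on how the function was truncated, so it passes to `L²` limits.
-/

namespace MarkovKDE

/-! ### Spectral gap of a reversible, geometrically ergodic chain. -/

section SpectralGap

variable {E : Type*} [MeasurableSpace E]

/-- Bounded measurable functions. -/
def IsBoundedMeasurable (u : E → ℝ) : Prop := Measurable u ∧ ∃ C, ∀ x, |u x| ≤ C

/-- The action of a kernel on functions. -/
noncomputable def average (P : Kernel E E) (u : E → ℝ) : E → ℝ := fun y => ∫ z, u z ∂P y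

namespace IsBoundedMeasurable

variable {u v : E → ℝ}

lemma integrable (hu : IsBoundedMeasurable u) (ν : Measure E) [IsFiniteMeasure ν] :
    Integrable u ν := by
  obtain ⟨hm, C, hC⟩ := hu
  exact Integrable.of_bound hm.aestronglyMeasurable C (ae_of_all _ hC)

lemma mul (hu : IsBoundedMeasurable u) (hv : IsBoundedMeasurable v) :
    IsBoundedMeasurable (fun x => u x * v x) := by
  obtain ⟨hm, C, hC⟩ := hu
  obtain ⟨hm', D, hD⟩ := hv
  refine ⟨hm.mul hm', C * D, fun x => ?_⟩
  rw [abs_mul]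
  exact mul_le_mul (hC x) (hD x) (abs_nonneg _) ((abs_nonneg _).trans (hC x))

lemma sub_const (hu : IsBoundedMeasurable u) (c : ℝ) :
    IsBoundedMeasurable (fun x => u x - c) := by
  obtain ⟨hm, C, hC⟩ := hu
  refine ⟨hm.sub_const c, C + |c|, fun x => ?_⟩
  exact (abs_sub _ _).trans (by gcongr; exact hC x)

lemma const (c : ℝ) : IsBoundedMeasurable (fun _ : E => c) :=
  ⟨measurable_const, |c|, fun _ => le_rfl⟩

lemma average (hu : IsBoundedMeasurable u) (P : Kernel E E) [IsMarkovKernel P] :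
    IsBoundedMeasurable (average P u) := by
  obtain ⟨hm, C, hC⟩ := hu
  refine ⟨(hm.stronglyMeasurable.integral_kernel (κ := P)).measurable, C, fun x => ?_⟩
  have := norm_integral_le_of_norm_le_const (μ := P x) (f := u) (C := C) (ae_of_all _ hC)
  simpa [MarkovKDE.average] using this

lemma iterate_average (hu : IsBoundedMeasurable u) (P : Kernel E E) [IsMarkovKernel P] (t : ℕ) :
    IsBoundedMeasurable ((MarkovKDE.average P)^[t] u) := by
  induction t with
  | zero => exact hu
  | succ t ih => rw [Function.iterate_succ_apply']; exact ih.average P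

end IsBoundedMeasurable

instance isMarkovKernel_stepKernel (P : Kernel E E) [IsMarkovKernel P] (t : ℕ) :
    IsMarkovKernel (stepKernel P t) := by
  induction t with
  | zero => simp only [stepKernel]; infer_instance
  | succ t ih => simp only [stepKernel]; infer_instance

lemma integral_stepKernel (P : Kernel E E) [IsMarkovKernel P] (t : ℕ) {u : E → ℝ}
    (hu : IsBoundedMeasurable u) (y : E) :
    ∫ z, u z ∂stepKernel P t y = (average P)^[t] u y := by
  induction t generalizing u with
  | zero => simp [stepKernel, Kernel.id_apply, integral_dirac' _ _ hu.1.stronglyMeasurable]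
  | succ t ih =>
    simp only [stepKernel]
    rw [Kernel.integral_comp ((hu.integrable _))]
    exact ih (hu.average P)

lemma average_sub_const (P : Kernel E E) [IsMarkovKernel P] {u : E → ℝ}
    (hu : IsBoundedMeasurable u) (c : ℝ) :
    average P (fun x => u x - c) = fun x => average P u x - c := by
  funext y
  simp only [average]
  rw [integral_sub (hu.integrable _) (integrable_const _)]
  simp

lemma iterate_average_sub_const (P : Kernel E E) [IsMarkovKernel P] {u : E → ℝ}
    (hu : IsBoundedMeasurable u) (c : ℝ) (t : ℕ) :
    (average P)^[t] (fun x => u x - c) = fun x => (average P)^[t] u x - c := by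
  induction t with
  | zero => rfl
  | succ t ih =>
    rw [Function.iterate_succ_apply', Function.iterate_succ_apply', ih,
      average_sub_const P (hu.iterate_average P t)]

lemma invariant_stepKernel {P : Kernel E E} {π : Measure E} (hinv : P.Invariant π) (t : ℕ) :
    (stepKernel P t).Invariant π := by
  induction t with
  | zero => exact Measure.id_comp
  | succ t ih => exact hinv.comp ih

variable {P : Kernel E E} [IsMarkovKernel P] {π : Measure E} [IsProbabilityMeasure π]

/-- Detailed balance is this symmetry tested on rectangles, which determine a measure on the
product. -/
lemma map_swap_compProd_of_isReversible (hrev : P.IsReversible π) :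
    (π ⊗ₘ P).map Prod.swap = π ⊗ₘ P := by
  have : IsProbabilityMeasure ((π ⊗ₘ P).map Prod.swap) :=
    Measure.isProbabilityMeasure_map measurable_swap.aemeasurable
  rw [Measure.ext_prod_iff]
  intro A B hA hB
  rw [Measure.map_apply measurable_swap (hA.prod hB), Set.preimage_swap_prod,
    Measure.compProd_apply_prod hB hA, Measure.compProd_apply_prod hA hB]
  exact hrev hB hA

lemma integral_mul_average {u v : E → ℝ} (hu : IsBoundedMeasurable u)
    (hv : IsBoundedMeasurable v) :
    ∫ y, u y * average P v y ∂π = ∫ z, u z.1 * v z.2 ∂(π ⊗ₘ P) := by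
  obtain ⟨hm, C, hC⟩ := hu
  obtain ⟨hm', D, hD⟩ := hv
  rw [Measure.integral_compProd]
  · refine integral_congr_ae (ae_of_all _ fun y => ?_)
    simp only [average]
    rw [integral_const_mul]
  · refine Integrable.of_bound
      ((hm.comp measurable_fst).mul (hm'.comp measurable_snd)).aestronglyMeasurable (C * D)
      (ae_of_all _ fun z => ?_)
    rw [Real.norm_eq_abs, abs_mul]
    exact mul_le_mul (hC _) (hD _) (abs_nonneg _) ((abs_nonneg _).trans (hC z.1))

lemma integral_mul_average_comm (hrev : P.IsReversible π) {u v : E → ℝ}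
    (hu : IsBoundedMeasurable u) (hv : IsBoundedMeasurable v) :
    ∫ y, u y * average P v y ∂π = ∫ y, average P u y * v y ∂π := by
  simp_rw [mul_comm (average P u _)]
  rw [integral_mul_average hu hv, integral_mul_average hv hu,
    ← map_swap_compProd_of_isReversible hrev,
    integral_map measurable_swap.aemeasurable, map_swap_compProd_of_isReversible hrev]
  · simp [mul_comm]
  · rw [map_swap_compProd_of_isReversible hrev]
    exact ((hu.1.comp measurable_fst).mul (hv.1.comp measurable_snd)).aestronglyMeasurable

lemma integral_mul_iterate_average_comm (hrev : P.IsReversible π) {u v : E → ℝ}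
    (hu : IsBoundedMeasurable u) (hv : IsBoundedMeasurable v) (t : ℕ) :
    ∫ y, u y * (average P)^[t] v y ∂π = ∫ y, (average P)^[t] u y * v y ∂π := by
  induction t generalizing u with
  | zero => rfl
  | succ t ih =>
    rw [Function.iterate_succ_apply', integral_mul_average_comm hrev hu (hv.iterate_average P t),
      ih (hu.average P), Function.iterate_succ_apply]

/-- Invariance of `π` is self-adjointness tested against the constant `1`, which `P` fixes. -/
lemma integral_iterate_average (hrev : P.IsReversible π) {u : E → ℝ}
    (hu : IsBoundedMeasurable u) (t : ℕ) :
    ∫ y, (average P)^[t] u y ∂π = ∫ y, u y ∂π := by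
  induction t with
  | zero => rfl
  | succ t ih =>
    have h := integral_mul_average_comm hrev (.const 1) (hu.iterate_average P t)
    rw [Function.iterate_succ_apply', ← ih]
    simpa [average] using h

/-- Cauchy–Schwarz, from the discriminant of the nonnegative quadratic `x ↦ ∫ (x u + v)²`. -/
lemma sq_integral_mul_le {u v : E → ℝ} (hu : IsBoundedMeasurable u)
    (hv : IsBoundedMeasurable v) :
    (∫ y, u y * v y ∂π) ^ 2 ≤ (∫ y, u y * u y ∂π) * ∫ y, v y * v y ∂π := by
  have h : ∀ x : ℝ, 0 ≤ (∫ y, u y * u y ∂π) * (x * x) + (2 * ∫ y, u y * v y ∂π) * x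
      + ∫ y, v y * v y ∂π := fun x => by
    have e : ∫ y, (x * u y + v y) ^ 2 ∂π = (∫ y, u y * u y ∂π) * (x * x)
        + (2 * ∫ y, u y * v y ∂π) * x + ∫ y, v y * v y ∂π := by
      have : ∀ y, (x * u y + v y) ^ 2 = (x * x) * (u y * u y) + (2 * x) * (u y * v y) + v y * v y :=
        fun y => by ring
      simp_rw [this]
      have i1 := ((hu.mul hu).integrable π).const_mul (x * x)
      have i2 := ((hu.mul hv).integrable π).const_mul (2 * x)
      rw [integral_add (by exact i1.add i2) ((hv.mul hv).integrable π), integral_add i1 i2,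
        integral_const_mul, integral_const_mul]
      ring
    rw [← e]
    exact integral_nonneg fun y => sq_nonneg _
  have := discrim_le_zero h
  rw [discrim] at this
  linarith

/-- A sequence that is log-convex along doublings and decays at the rate `ρ` does so with the
constant given by its initial value. -/
lemma abs_le_of_sq_le_mul {a : ℕ → ℝ} {C ρ : ℝ} (hρ : 0 < ρ) (h0 : 0 ≤ a 0)
    (hsq : ∀ t, a t ^ 2 ≤ a 0 * a (2 * t)) (hC : ∀ t, |a t| ≤ C * ρ ^ t) (t : ℕ) :
    |a t| ≤ ρ ^ t * a 0 := by
  rcases h0.eq_or_lt with h | h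
  · have := hsq t
    rw [← h, zero_mul] at this
    have : a t = 0 := by nlinarith
    simp [this, ← h]
  by_contra! hlt
  -- The normalized ratio satisfies `b s ^ 2 ≤ b (2 s)` and stays below `C / a 0`. A value `b t > 1`
  -- would make `b (2 ^ k t) ≥ b t ^ (2 ^ k)` unbounded.
  set b : ℕ → ℝ := fun s => |a s| / (a 0 * ρ ^ s) with hb
  have hb2 : ∀ s, b s ^ 2 ≤ b (2 * s) := fun s => by
    simp only [hb]
    rw [div_pow, div_le_div_iff₀ (by positivity) (by positivity)]
    have : |a s| ^ 2 ≤ a 0 * |a (2 * s)| := by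
      rw [sq_abs]
      exact (hsq s).trans (by gcongr; exact le_abs_self _)
    calc |a s| ^ 2 * (a 0 * ρ ^ (2 * s)) ≤ a 0 * |a (2 * s)| * (a 0 * ρ ^ (2 * s)) := by gcongr
      _ = |a (2 * s)| * (a 0 * ρ ^ s) ^ 2 := by ring
  have hb0 : ∀ s, 0 ≤ b s := fun s => by positivity
  have hpow : ∀ k, b t ^ (2 ^ k) ≤ b (2 ^ k * t) := fun k => by
    induction k with
    | zero => simp
    | succ k ih =>
      calc b t ^ 2 ^ (k + 1) = (b t ^ 2 ^ k) ^ 2 := by rw [pow_succ, pow_mul]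
        _ ≤ b (2 ^ k * t) ^ 2 := by gcongr
        _ ≤ b (2 * (2 ^ k * t)) := hb2 _
        _ = b (2 ^ (k + 1) * t) := by congr 1; ring
  have hbC : ∀ s, b s ≤ C / a 0 := fun s => by
    simp only [hb]
    rw [div_le_div_iff₀ (by positivity) h]
    calc |a s| * a 0 ≤ C * ρ ^ s * a 0 := by gcongr; exact hC s
      _ = C * (a 0 * ρ ^ s) := by ring
  have h1 : 1 < b t := by
    simp only [hb]
    rw [one_lt_div (by positivity)]
    linarith
  obtain ⟨k, hk⟩ := ((tendsto_pow_atTop_atTop_of_one_lt h1).eventually_gt_atTop (C / a 0)).exists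
  have : b t ^ k ≤ b t ^ 2 ^ k := pow_le_pow_right₀ h1.le Nat.lt_two_pow_self.le
  linarith [hpow k, hbC (2 ^ k * t)]

lemma abs_sub_le_tvDist (μ ν : Measure E) [IsProbabilityMeasure μ] [IsProbabilityMeasure ν]
    {A : Set E} (hA : MeasurableSet A) : |μ.real A - ν.real A| ≤ tvDist μ ν := by
  refine le_ciSup (f := fun A : {A : Set E // MeasurableSet A} => |μ.real A - ν.real A|)
    ⟨1, ?_⟩ ⟨A, hA⟩
  rintro _ ⟨B, rfl⟩
  have h1 := measureReal_le_one (μ := μ) (s := (B : Set E))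
  have h2 := measureReal_le_one (μ := ν) (s := (B : Set E))
  have h3 : 0 ≤ μ.real B := measureReal_nonneg
  have h4 : 0 ≤ ν.real B := measureReal_nonneg
  exact abs_le.2 ⟨by linarith, by linarith⟩

lemma tvDist_nonneg (μ ν : Measure E) : 0 ≤ tvDist μ ν := Real.iSup_nonneg fun _ => abs_nonneg _

lemma isBoundedMeasurable_simpleFunc (s : SimpleFunc E ℝ) : IsBoundedMeasurable s :=
  ⟨s.measurable, s.exists_forall_norm_le⟩

/-- The constant is the sum of the absolute values taken by `s`. It is crude, but it depends on `s`
alone, and it disappears in `abs_le_of_sq_le_mul`. -/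
lemma abs_integral_simpleFunc_sub_le (s : SimpleFunc E ℝ) :
    ∃ C, 0 ≤ C ∧ ∀ (μ ν : Measure E) [IsProbabilityMeasure μ] [IsProbabilityMeasure ν],
      |∫ x, s x ∂μ - ∫ x, s x ∂ν| ≤ C * tvDist μ ν := by
  refine ⟨∑ c ∈ s.range, |c|, Finset.sum_nonneg fun _ _ => abs_nonneg _, fun μ ν _ _ => ?_⟩
  rw [← SimpleFunc.integral_eq_integral s ((isBoundedMeasurable_simpleFunc s).integrable μ),
    ← SimpleFunc.integral_eq_integral s ((isBoundedMeasurable_simpleFunc s).integrable ν),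
    SimpleFunc.integral_eq, SimpleFunc.integral_eq, ← Finset.sum_sub_distrib, Finset.sum_mul]
  refine (Finset.abs_sum_le_sum_abs _ _).trans (Finset.sum_le_sum fun c _ => ?_)
  rw [smul_eq_mul, smul_eq_mul, ← sub_mul, abs_mul, mul_comm]
  gcongr
  exact abs_sub_le_tvDist μ ν (s.measurableSet_preimage _)

lemma integral_comp_fst_mul_snd {u v : E → ℝ} (hu : IsBoundedMeasurable u)
    (hv : IsBoundedMeasurable v) (t : ℕ) :
    ∫ z, u z.1 * v z.2 ∂(π ⊗ₘ stepKernel P t) = ∫ y, u y * (average P)^[t] v y ∂π := by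
  rw [← integral_mul_average hu hv]
  simp_rw [← integral_stepKernel P t hv]
  rfl

/-- The spectral gap, for simple functions that vanish off a set on which the convergence to
equilibrium is uniform. -/
lemma abs_autocovariance_simpleFunc_le (hrev : P.IsReversible π) {M : E → ℝ} {ρ m : ℝ}
    (hρ : 0 < ρ) (hM : ∀ y t, tvDist (stepKernel P t y) π ≤ M y * ρ ^ t) (s : SimpleFunc E ℝ)
    {B : Set E}
    (hB : ∀ T : Set E, MeasurableSet T → {y | M y ≤ m} ⊆ T → ∀ᵐ y ∂π, y ∈ B → y ∈ T)
    (hs : ∀ y, y ∉ B → s y = 0) (t : ℕ) :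
    |∫ z, s z.1 * s z.2 ∂(π ⊗ₘ stepKernel P t) - (∫ y, s y ∂π) ^ 2|
      ≤ ρ ^ t * (∫ y, s y ^ 2 ∂π - (∫ y, s y ∂π) ^ 2) := by
  have hsb := isBoundedMeasurable_simpleFunc s
  set c := ∫ y, s y ∂π with hc
  have hub := hsb.sub_const c
  obtain ⟨C, hC0, hC⟩ := abs_integral_simpleFunc_sub_le s
  set a : ℕ → ℝ := fun t => ∫ y, (s y - c) * (average P)^[t] (fun x => s x - c) y ∂π with ha
  -- Only one factor needs centring, because `P^t s - c` has mean zero. The other factor stays `s`,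
  -- which vanishes off `B`, so convergence to equilibrium is only needed on `B`.
  have hexp : ∀ t, a t = ∫ y, s y * ((average P)^[t] s y - c) ∂π := fun t => by
    have h1 : ∫ y, ((average P)^[t] s y - c) ∂π = 0 := by
      rw [integral_sub ((hsb.iterate_average P t).integrable π) (integrable_const _),
        integral_iterate_average hrev hsb]
      simp [hc]
    simp only [ha, iterate_average_sub_const P hsb]
    simp_rw [sub_mul]
    rw [integral_sub ((hsb.mul ((hsb.iterate_average P t).sub_const c)).integrable π)
      ((((hsb.iterate_average P t).sub_const c).integrable π).const_mul c), integral_const_mul, h1]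
    simp
  have hval : ∀ t, a t = ∫ z, s z.1 * s z.2 ∂(π ⊗ₘ stepKernel P t) - c ^ 2 := fun t => by
    rw [hexp, integral_comp_fst_mul_snd hsb hsb]
    simp_rw [mul_sub]
    rw [integral_sub ((hsb.mul (hsb.iterate_average P t)).integrable π)
      ((hsb.integrable π).mul_const c), integral_mul_const]
    ring
  have hval0 : a 0 = ∫ y, s y ^ 2 ∂π - c ^ 2 := by
    rw [hval, integral_comp_fst_mul_snd hsb hsb]
    simp [sq]
  rw [← hval, ← hval0]
  refine abs_le_of_sq_le_mul (C := (∫ y, |s y| ∂π) * (C * |m|)) hρ ?_ ?_ ?_ t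
  · exact integral_nonneg fun y => mul_self_nonneg _
  · intro t
    -- Self-adjointness splits `P^{2t}` evenly, so `a (2 t)` is a squared norm and Cauchy–Schwarz
    -- gives the log-convexity.
    have h2 : a (2 * t) = ∫ y, (average P)^[t] (fun x => s x - c) y
        * (average P)^[t] (fun x => s x - c) y ∂π := by
      rw [← integral_mul_iterate_average_comm hrev hub (hub.iterate_average P t)]
      simp only [ha, two_mul, Function.iterate_add_apply]
    rw [h2]
    exact sq_integral_mul_le hub (hub.iterate_average P t)
  · intro t
    have hae : ∀ᵐ y ∂π, y ∈ B → |(average P)^[t] s y - c| ≤ C * |m| * ρ ^ t := by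
      -- `M` need not be measurable. The set where the desired bound holds is measurable and
      -- contains `{M ≤ m}`, hence contains almost all of `B`.
      refine hB {y | |(average P)^[t] s y - c| ≤ C * |m| * ρ ^ t} ?_ fun y (hy : M y ≤ m) => ?_
      · exact measurableSet_le ((hsb.iterate_average P t).1.sub_const c).norm measurable_const
      · have h1 := hC (stepKernel P t y) π
        rw [integral_stepKernel P t hsb] at h1
        refine h1.trans ?_
        rw [mul_assoc]
        gcongr
        exact (hM y t).trans (by gcongr; exact hy.trans (le_abs_self m))
    rw [hexp, ← Real.norm_eq_abs]
    refine (norm_integral_le_integral_norm _).trans ?_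
    rw [mul_assoc, ← integral_mul_const]
    refine integral_mono_ae ((hsb.mul ((hsb.iterate_average P t).sub_const c)).integrable π).norm
      ((hsb.integrable π).norm.mul_const _) ?_
    filter_upwards [hae] with y hy
    rw [norm_mul]
    by_cases hyB : y ∈ B
    · exact mul_le_mul_of_nonneg_left (hy hyB) (norm_nonneg _)
    · simp [hs y hyB]

lemma snd_compProd_stepKernel (hinv : P.Invariant π) (t : ℕ) :
    (π ⊗ₘ stepKernel P t).snd = π := by
  rw [Measure.snd_compProd]
  exact invariant_stepKernel hinv t

/-- The spectral gap of a geometrically ergodic reversible chain: the autocovariances of a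
square integrable function decay geometrically relative to its variance. -/
lemma GeometricallyErgodic.abs_autocovariance_le (hgeo : GeometricallyErgodic P π)
    (hrev : P.IsReversible π) :
    ∃ ρ : ℝ, 0 < ρ ∧ ρ < 1 ∧ ∀ (g : E → ℝ) (_ : Measurable g) (_ : Integrable (fun y => g y ^ 2) π)
      (t : ℕ), |∫ z, g z.1 * g z.2 ∂(π ⊗ₘ stepKernel P t) - (∫ y, g y ∂π) ^ 2|
        ≤ ρ ^ t * (∫ y, g y ^ 2 ∂π - (∫ y, g y ∂π) ^ 2) := by
  obtain ⟨M, ρ₀, h0, h1, hM₀⟩ := hgeo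
  -- The rate is enlarged to be positive, since the doubling argument divides by powers of `ρ`.
  set ρ := max ρ₀ (1 / 2) with hρdef
  have hρ : 0 < ρ := lt_max_of_lt_right (by norm_num)
  have hM : ∀ y t, tvDist (stepKernel P t y) π ≤ M y * ρ ^ t := fun y t => by
    have : 0 ≤ M y := by simpa using (tvDist_nonneg _ _).trans (hM₀ y 0)
    exact (hM₀ y t).trans (by gcongr; exact le_max_left _ _)
  refine ⟨ρ, hρ, max_lt h1 (by norm_num), fun g hg hg2 t => ?_⟩
  -- Measurable hulls replace the possibly nonmeasurable sublevel sets of `M`. Taking unions over `k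
  -- ≤ m` makes the sequence increasing, so that each point eventually stays in `B m`.
  set B : ℕ → Set E := fun m => ⋃ k ∈ Finset.range (m + 1), toMeasurable π {y | M y ≤ k} with hBdef
  have hBm : ∀ m, MeasurableSet (B m) := fun m =>
    Finset.measurableSet_biUnion _ fun k _ => measurableSet_toMeasurable _ _
  have hBmono : ∀ y, ∀ᶠ m in atTop, y ∈ B m := fun y => by
    obtain ⟨k, hk⟩ := exists_nat_ge (M y)
    filter_upwards [eventually_ge_atTop k] with m hm
    simp only [hBdef, Set.mem_iUnion]
    exact ⟨k, Finset.mem_range.2 (by omega), subset_toMeasurable _ _ hk⟩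
  have hBhull : ∀ (m : ℕ) (T : Set E), MeasurableSet T → {y | M y ≤ m} ⊆ T →
      ∀ᵐ y ∂π, y ∈ B m → y ∈ T := fun m T hT hsub => by
    have : ∀ k ∈ Finset.range (m + 1), ∀ᵐ y ∂π, y ∈ toMeasurable π {y | M y ≤ k} → y ∈ T := by
      intro k hk
      have hsub' : {y | M y ≤ k} ⊆ T := fun y (hy : M y ≤ k) => hsub (by
        have : (k : ℝ) ≤ m := by exact_mod_cast (by simpa using hk : k ≤ m)
        exact hy.trans this)
      rw [ae_iff]
      -- A hull meets the measurable set `Tᶜ` in the same measure as the original set does, namely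
      -- zero.
      have h2 := Measure.measure_toMeasurable_inter (μ := π) hT.compl
        (measure_ne_top π {y | M y ≤ k})
      have h3 : {y | M y ≤ (k : ℝ)} ∩ Tᶜ = ∅ := by
        rw [← Set.sdiff_eq, Set.sdiff_eq_empty]
        exact hsub'
      rw [h3, measure_empty] at h2
      rw [← h2]
      congr 1
      ext y
      simp
    rw [← Finset.eventually_all] at this
    filter_upwards [this] with y hy hyB
    simp only [hBdef, Set.mem_iUnion] at hyB
    obtain ⟨k, hk, hyk⟩ := hyB
    exact hy k hk hyk
  -- Simple approximations of `g` cut off to `B m`: they converge pointwise and are dominated by `2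
  -- |g|`, so all three integrals pass to the limit.
  set s : ℕ → SimpleFunc E ℝ := fun m =>
    (SimpleFunc.approxOn g hg Set.univ 0 (Set.mem_univ _) m).restrict (B m) with hsdef
  have hsval : ∀ m y, s m y = (B m).indicator
      (SimpleFunc.approxOn g hg Set.univ 0 (Set.mem_univ _) m) y := fun m y => by
    simp only [hsdef]
    rw [SimpleFunc.restrict_apply _ (hBm m)]
  have hslim : ∀ y, Tendsto (fun m => s m y) atTop (𝓝 (g y)) := fun y => by
    refine (SimpleFunc.tendsto_approxOn hg (Set.mem_univ (0 : ℝ))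
      (by simp : g y ∈ closure Set.univ)).congr' ?_
    filter_upwards [hBmono y] with m hm
    rw [hsval, Set.indicator_of_mem hm]
  have hsle : ∀ m y, |s m y| ≤ 2 * |g y| := fun m y => by
    rw [hsval]
    refine (norm_indicator_le_norm_self (E := ℝ) _ y).trans ?_
    have := SimpleFunc.norm_approxOn_zero_le hg (Set.mem_univ (0 : ℝ)) y m
    simp only [Real.norm_eq_abs] at this ⊢
    linarith
  have hgL : MemLp g 2 π := (memLp_two_iff_integrable_sq hg.aestronglyMeasurable).2 hg2
  have hinv := hrev.invariant
  have hfst : MeasurePreserving (Prod.fst : E × E → E) (π ⊗ₘ stepKernel P t) π :=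
    ⟨measurable_fst, Measure.fst_compProd π _⟩
  have hsnd : MeasurePreserving (Prod.snd : E × E → E) (π ⊗ₘ stepKernel P t) π :=
    ⟨measurable_snd, snd_compProd_stepKernel hinv t⟩
  have hgg : Integrable (fun z : E × E => g z.1 * g z.2) (π ⊗ₘ stepKernel P t) :=
    (hgL.comp_measurePreserving hfst).integrable_mul (hgL.comp_measurePreserving hsnd)
  have l1 : Tendsto (fun m => ∫ y, s m y ∂π) atTop (𝓝 (∫ y, g y ∂π)) := by
    refine tendsto_integral_of_dominated_convergence (fun y => 2 * |g y|)
      (fun m => (s m).measurable.aestronglyMeasurable)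
      ((hgL.integrable one_le_two).abs.const_mul 2)
      (fun m => ae_of_all _ (hsle m)) (ae_of_all _ hslim)
  have l2 : Tendsto (fun m => ∫ y, s m y ^ 2 ∂π) atTop (𝓝 (∫ y, g y ^ 2 ∂π)) := by
    refine tendsto_integral_of_dominated_convergence (fun y => 4 * g y ^ 2)
      (fun m => ((s m).measurable.pow_const 2).aestronglyMeasurable) (hg2.const_mul 4)
      (fun m => ae_of_all _ fun y => ?_) (ae_of_all _ fun y => (hslim y).pow 2)
    have := pow_le_pow_left₀ (abs_nonneg _) (hsle m y) 2
    rw [norm_pow, Real.norm_eq_abs]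
    rw [mul_pow, sq_abs (g y)] at this
    linarith
  have l3 : Tendsto (fun m => ∫ z, s m z.1 * s m z.2 ∂(π ⊗ₘ stepKernel P t)) atTop
      (𝓝 (∫ z, g z.1 * g z.2 ∂(π ⊗ₘ stepKernel P t))) := by
    refine tendsto_integral_of_dominated_convergence (fun z => 4 * |g z.1 * g z.2|)
      (fun m => (((s m).measurable.comp measurable_fst).mul
        ((s m).measurable.comp measurable_snd)).aestronglyMeasurable) (hgg.abs.const_mul 4)
      (fun m => ae_of_all _ fun z => ?_) (ae_of_all _ fun z => (hslim z.1).mul (hslim z.2))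
    rw [Real.norm_eq_abs, abs_mul, abs_mul]
    have := mul_le_mul (hsle m z.1) (hsle m z.2) (abs_nonneg _) (by positivity)
    linarith
  refine le_of_tendsto_of_tendsto' (l3.sub (l1.pow 2)).abs
    ((l2.sub (l1.pow 2)).const_mul (ρ ^ t)) fun m => ?_
  exact abs_autocovariance_simpleFunc_le hrev hρ hM (s m) (hBhull m)
    (fun y hy => by rw [hsval, Set.indicator_of_notMem hy]) t

end SpectralGap

/-! ### Two-time laws and covariances of the stationary chain. -/

section ChainLaw

/-- Integrating the conditional probability over an event of the past turns the Markov property into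
an identity between measures. -/
lemma measure_inter_eq_setLIntegral_of_condExp {Ω : Type*} {m m₀ : MeasurableSpace Ω}
    {μ : Measure Ω} [IsProbabilityMeasure μ] (hm : m ≤ m₀) {s B : Set Ω} (hs : MeasurableSet[m] s)
    (hB : MeasurableSet B) {q : Ω → ENNReal} (hq : Measurable q) (hq1 : ∀ ω, q ω ≤ 1)
    (h : μ[B.indicator (fun _ => (1 : ℝ)) | m] =ᵐ[μ] fun ω => (q ω).toReal) :
    μ (s ∩ B) = ∫⁻ ω in s, q ω ∂μ := by
  have h1 := setIntegral_condExp hm (μ := μ) ((integrable_const (1 : ℝ)).indicator hB) hs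
  rw [setIntegral_congr_ae (hm _ hs) (h.mono fun x hx _ => hx), setIntegral_indicator hB,
    integral_toReal hq.aemeasurable
      (ae_of_all _ fun ω => (hq1 ω).trans_lt ENNReal.one_lt_top)] at h1
  simp only [integral_const, smul_eq_mul, mul_one, measureReal_def, Measure.restrict_apply_univ]
    at h1
  refine ((ENNReal.toReal_eq_toReal_iff' ?_ (measure_ne_top _ _)).1 h1).symm
  refine ne_top_of_le_ne_top (measure_ne_top μ s) ((lintegral_mono hq1).trans ?_)
  simp

variable {E : Type*} [MeasurableSpace E] {Ω : Type*} [MeasurableSpace Ω] {μ : Measure Ω}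
  [IsProbabilityMeasure μ] {Y : ℕ → Ω → E} {P : Kernel E E} [IsMarkovKernel P] {π : Measure E}

lemma IsMarkovChain.measure_inter (hY : IsMarkovChain μ Y P π) {i n : ℕ} (hi : i ≤ n)
    {A B : Set E} (hA : MeasurableSet A) (hB : MeasurableSet B) :
    μ (Y i ⁻¹' A ∩ Y (n + 1) ⁻¹' B) = ∫⁻ ω in Y i ⁻¹' A, P (Y n ω) B ∂μ := by
  refine measure_inter_eq_setLIntegral_of_condExp (iSup_le fun j : Fin (n + 1) => (hY.measurable j).comap_le)
    ?_ (hY.measurable _ hB) ((P.measurable_coe hB).comp (hY.measurable n)) (fun ω => prob_le_one)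
    (hY.markov n B hB)
  exact (le_iSup (fun i : Fin (n + 1) => MeasurableSpace.comap (Y i) inferInstance)
    ⟨i, by omega⟩) _ ⟨A, hA, rfl⟩

/-- Induction on the lag: conditioning on the past up to time `i + t`, which contains `Y i`,
composes the `t`-step kernel with one more `P`. -/
lemma IsMarkovChain.map_pair (hY : IsMarkovChain μ Y P π) (i t : ℕ) :
    μ.map (fun ω => (Y i ω, Y (i + t) ω)) = (μ.map (Y i)) ⊗ₘ stepKernel P t := by
  have hpr : IsProbabilityMeasure (μ.map (Y i)) :=
    Measure.isProbabilityMeasure_map (hY.measurable i).aemeasurable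
  induction t with
  | zero =>
    simp only [stepKernel, Measure.compProd_id, add_zero]
    rw [Measure.map_map measurable_diag (hY.measurable i)]
    rfl
  | succ t ih =>
    have hpm : Measurable fun ω => (Y i ω, Y (i + t) ω) :=
      (hY.measurable i).prodMk (hY.measurable _)
    have hpm' : Measurable fun ω => (Y i ω, Y (i + (t + 1)) ω) :=
      (hY.measurable i).prodMk (hY.measurable _)
    have : IsProbabilityMeasure (μ.map fun ω => (Y i ω, Y (i + (t + 1)) ω)) :=
      Measure.isProbabilityMeasure_map hpm'.aemeasurable
    rw [Measure.ext_prod_iff]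
    intro A B hA hB
    rw [Measure.map_apply hpm' (hA.prod hB), Measure.compProd_apply_prod hA hB, Set.mk_preimage_prod,
      show i + (t + 1) = i + t + 1 from rfl, hY.measure_inter (Nat.le_add_right i t) hA hB]
    have hPB : Measurable fun z : E × E => P z.2 B := (P.measurable_coe hB).comp measurable_snd
    calc ∫⁻ ω in Y i ⁻¹' A, P (Y (i + t) ω) B ∂μ
        = ∫⁻ z in A ×ˢ Set.univ, P z.2 B ∂(μ.map fun ω => (Y i ω, Y (i + t) ω)) := by
          rw [setLIntegral_map (hA.prod .univ) hPB hpm]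
          simp [Set.mk_preimage_prod]
      _ = ∫⁻ y in A, ∫⁻ z, P z B ∂stepKernel P t y ∂(μ.map (Y i)) := by
          rw [ih, Measure.setLIntegral_compProd hPB hA .univ]
          simp
      _ = ∫⁻ y in A, stepKernel P (t + 1) y B ∂(μ.map (Y i)) := by
          simp only [stepKernel]
          simp_rw [Kernel.comp_apply' _ _ _ hB]

lemma IsMarkovChain.map_eq (hY : IsMarkovChain μ Y P π) (hinv : P.Invariant π) (i : ℕ) :
    μ.map (Y i) = π := by
  have : IsProbabilityMeasure π := by
    rw [← hY.initial]
    exact Measure.isProbabilityMeasure_map (hY.measurable 0).aemeasurable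
  have h := congrArg Measure.snd (hY.map_pair 0 i)
  rw [hY.initial, snd_compProd_stepKernel hinv, Measure.snd, Measure.map_map measurable_snd
    ((hY.measurable 0).prodMk (hY.measurable _)), zero_add] at h
  exact h

section Covariance

variable {g : E → ℝ}

lemma IsMarkovChain.memLp (hY : IsMarkovChain μ Y P π) (hinv : P.Invariant π)
    (hg : MemLp g 2 π) (i : ℕ) : MemLp (fun ω => g (Y i ω)) 2 μ :=
  hg.comp_measurePreserving ⟨hY.measurable i, hY.map_eq hinv i⟩

lemma IsMarkovChain.integral_comp (hY : IsMarkovChain μ Y P π) (hinv : P.Invariant π)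
    (hg : Measurable g) (i : ℕ) : ∫ ω, g (Y i ω) ∂μ = ∫ y, g y ∂π := by
  rw [← hY.map_eq hinv i, integral_map (hY.measurable i).aemeasurable hg.aestronglyMeasurable]

lemma IsMarkovChain.covariance_eq (hY : IsMarkovChain μ Y P π) (hinv : P.Invariant π)
    (hg : Measurable g) (hg2 : MemLp g 2 π) (i t : ℕ) :
    cov[fun ω => g (Y i ω), fun ω => g (Y (i + t) ω); μ]
      = ∫ z, g z.1 * g z.2 ∂(π ⊗ₘ stepKernel P t) - (∫ y, g y ∂π) ^ 2 := by
  rw [covariance_eq_sub (hY.memLp hinv hg2 i) (hY.memLp hinv hg2 _), hY.integral_comp hinv hg,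
    hY.integral_comp hinv hg, ← sq]
  congr 1
  conv_rhs => rw [← hY.map_eq hinv i]
  have hm : Measurable fun z : E × E => g z.1 * g z.2 :=
    (hg.comp measurable_fst).mul (hg.comp measurable_snd)
  rw [← hY.map_pair i t, integral_map
    ((hY.measurable i).prodMk (hY.measurable _)).aemeasurable hm.aestronglyMeasurable]
  rfl

lemma IsMarkovChain.variance_eq (hY : IsMarkovChain μ Y P π) (hinv : P.Invariant π)
    (hg : Measurable g) (hg2 : MemLp g 2 π) (i : ℕ) :
    Var[fun ω => g (Y i ω); μ] = ∫ y, g y ^ 2 ∂π - (∫ y, g y ∂π) ^ 2 := by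
  rw [variance_eq_sub (hY.memLp hinv hg2 i), hY.integral_comp hinv hg]
  congr 1
  exact hY.integral_comp hinv (hg.pow_const 2) i

end Covariance

end ChainLaw

/-! ### Sums over lags. -/

section LagSums

lemma sum_Icc_eq_add_two_mul (F : ℕ → ℝ) (n : ℕ) :
    ∑ t ∈ Finset.Icc (-(n : ℤ)) n, F t.natAbs
      = F 0 + 2 * ∑ k ∈ Finset.range n, F (k + 1) := by
  rw [Finset.sum_Icc_of_even_eq_range (f := fun t : ℤ => F t.natAbs)
    (fun t => by simp [Int.natAbs_neg]), Finset.sum_range_succ', two_nsmul]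
  have : ∀ k : ℕ, ((k + 1 : ℕ) : ℤ).natAbs = k + 1 := fun k => rfl
  simp_rw [this]
  simp
  ring

/-- A double sum depending only on the distance of the indices, written as a sum over the lags. -/
lemma sum_sum_eq_sum_lags (c : ℕ → ℕ → ℝ) (hc : ∀ i j, c i j = c j i) (γ : ℕ → ℝ)
    (hγ : ∀ i t, c i (i + t) = γ t) (n : ℕ) :
    ∑ i ∈ Finset.range n, ∑ j ∈ Finset.range n, c i j
      = ∑ t ∈ Finset.Ioo (-(n : ℤ)) n, ((n : ℝ) - |(t : ℝ)|) * γ t.natAbs := by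
  have habs : ∀ t : ℤ, |(t : ℝ)| = (t.natAbs : ℝ) := fun t => by
    rw [Nat.cast_natAbs, Int.cast_abs]
  -- The extreme lags `±n` have weight zero. Closing the interval lets the induction step raise
  -- every weight on one fixed index set by `1`.
  have hIcc : ∀ n : ℕ, ∑ t ∈ Finset.Ioo (-(n : ℤ)) n, ((n : ℝ) - |(t : ℝ)|) * γ t.natAbs
      = ∑ t ∈ Finset.Icc (-(n : ℤ)) n, ((n : ℝ) - |(t : ℝ)|) * γ t.natAbs := fun n => by
    refine Finset.sum_subset Finset.Ioo_subset_Icc_self fun t ht ht' => ?_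
    have : t.natAbs = n := by
      simp only [Finset.mem_Icc, Finset.mem_Ioo] at ht ht'
      omega
    rw [habs, this, sub_self, zero_mul]
  induction n with
  | zero => simp
  | succ n ih =>
    have hI : Finset.Ioo (-((n + 1 : ℕ) : ℤ)) ((n + 1 : ℕ) : ℤ) = Finset.Icc (-(n : ℤ)) n := by
      ext t
      simp only [Finset.mem_Icc, Finset.mem_Ioo]
      omega
    have hrow : ∑ i ∈ Finset.range n, c i n = ∑ k ∈ Finset.range n, γ (k + 1) := by
      rw [← Finset.sum_range_reflect]
      refine Finset.sum_congr rfl fun k hk => ?_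
      rw [← hγ (n - 1 - k) (k + 1)]
      have := Finset.mem_range.1 hk
      congr 1
      omega
    rw [hI]
    push_cast
    -- The extra `γ` for each lag `|t| ≤ n` accounts for the new row, column and diagonal entry of
    -- the double sum.
    have : ∀ t : ℤ, ((n : ℝ) + 1 - |(t : ℝ)|) * γ t.natAbs
        = ((n : ℝ) - |(t : ℝ)|) * γ t.natAbs + γ t.natAbs := fun t => by ring
    simp_rw [this]
    rw [Finset.sum_add_distrib, sum_Icc_eq_add_two_mul γ, ← hIcc, ← ih, Finset.sum_range_succ]
    simp_rw [Finset.sum_range_succ (fun j => c _ j)]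
    rw [Finset.sum_add_distrib, hrow]
    simp_rw [hc n]
    rw [hrow]
    have := hγ n 0
    rw [add_zero] at this
    rw [this]
    ring

lemma sum_Ioo_pow_natAbs_le {ρ : ℝ} (h0 : 0 ≤ ρ) (h1 : ρ < 1) (n : ℕ) :
    ∑ t ∈ Finset.Ioo (-(n : ℤ)) n, ρ ^ t.natAbs ≤ 2 / (1 - ρ) := by
  refine (Finset.sum_le_sum_of_subset_of_nonneg Finset.Ioo_subset_Icc_self
    fun t _ _ => pow_nonneg h0 _).trans ?_
  rw [sum_Icc_eq_add_two_mul (fun k => ρ ^ k)]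
  have hs : ∑ k ∈ Finset.range (n + 1), ρ ^ k ≤ (1 - ρ)⁻¹ := by
    rw [← tsum_geometric_of_lt_one h0 h1]
    exact (summable_geometric_of_lt_one h0 h1).sum_le_tsum _ fun k _ => pow_nonneg h0 _
  rw [Finset.sum_range_succ'] at hs
  rw [div_eq_mul_inv]
  have : ρ ^ 0 = 1 := pow_zero ρ
  linarith

end LagSums

/-! ### Variance of the estimator and the bound on the autocorrelation time. -/

section EstimatorVariance

variable {S : Set ℝ} {Ω : Type*} [MeasurableSpace Ω] {μ : Measure Ω}
  [IsProbabilityMeasure μ] {Y : ℕ → Ω → S} {P : Kernel S S} [IsMarkovKernel P] {π : Measure S}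
  {K : ℝ → ℝ}

lemma measurable_scaled_sub (hK : Measurable K) (h x : ℝ) :
    Measurable fun y : ℝ => scaled K h (x - y) := by
  unfold scaled
  fun_prop

lemma kde_eq_sum_scaled {Ω : Type*} (K : ℝ → ℝ) (Y : ℕ → Ω → ℝ) (n : ℕ) (h x : ℝ) (ω : Ω) :
    kde K Y n h x ω = (1 / (n : ℝ)) * ∑ i ∈ Finset.range n, scaled K h (x - Y i ω) := by
  simp only [kde, scaled, ← Finset.sum_div]
  rw [one_div, one_div, mul_inv]
  ring

/-- The variance of the kernel density estimator in terms of the integrated autocorrelation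
time. -/
lemma IsMarkovChain.variance_kde (hY : IsMarkovChain μ Y P π) (hgeo : GeometricallyErgodic P π)
    (hrev : P.IsReversible π) (hK : Measurable K) (n : ℕ) (hn : 1 ≤ n) (h x : ℝ)
    (hg2 : MemLp (fun y : S => scaled K h (x - y)) 2 π) :
    Var[kde K (fun i ω => (Y i ω : ℝ)) n h x; μ]
      = 1 / n * (Var[fun ω => scaled K h (x - Y 0 ω); μ] *
        tau μ K (fun i ω => (Y i ω : ℝ)) n h x) := by
  have : IsProbabilityMeasure π := by
    rw [← hY.initial]
    exact Measure.isProbabilityMeasure_map (hY.measurable 0).aemeasurable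
  have hinv := hrev.invariant
  obtain ⟨ρ, hρ0, hρ1, hgap⟩ := hgeo.abs_autocovariance_le hrev
  set g : S → ℝ := fun y => scaled K h (x - y) with hgdef
  have hg : Measurable g := (measurable_scaled_sub hK h x).comp measurable_subtype_coe
  have hcov := hY.covariance_eq hinv hg hg2
  have hvar := hY.variance_eq hinv hg hg2
  set V := ∫ y, g y ^ 2 ∂π - (∫ y, g y ∂π) ^ 2 with hV
  set γ : ℕ → ℝ := fun t => ∫ z, g z.1 * g z.2 ∂(π ⊗ₘ stepKernel P t) - (∫ y, g y ∂π) ^ 2 with hγ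
  have hV0 : 0 ≤ V := by
    rw [← hvar 0]
    exact variance_nonneg _ _
  have hcorr : ∀ t : ℕ, γ t = V * corr μ (fun ω => scaled K h (x - Y 0 ω))
      (fun ω => scaled K h (x - Y t ω)) := fun t => by
    have hc := hcov 0 t
    have hgt := hgap g hg hg2.integrable_sq t
    rw [zero_add] at hc
    rw [corr, hvar t, hvar 0, hc, Real.mul_self_sqrt hV0]
    -- If the variance vanishes, the spectral gap forces the covariance to vanish too, so the
    -- convention that the correlation is `0` is harmless.
    rcases hV0.eq_or_lt with h0 | h0
    · rw [← hV, ← h0, mul_zero] at hgt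
      rw [← h0]
      simpa using hgt
    · field_simp
      rfl
  have hkde : kde K (fun i ω => (Y i ω : ℝ)) n h x
      = fun ω => (1 / (n : ℝ)) * ∑ i ∈ Finset.range n, g (Y i ω) := by
    funext ω
    rw [kde_eq_sum_scaled]
  have hn0 : (n : ℝ) ≠ 0 := by positivity
  have hm : Measurable fun ω => ∑ i ∈ Finset.range n, g (Y i ω) :=
    Finset.measurable_sum _ fun i _ => hg.comp (hY.measurable i)
  rw [hkde, variance_const_mul, hvar 0, ← covariance_self hm.aemeasurable,
    covariance_fun_sum_fun_sum' (fun i _ => hY.memLp hinv hg2 i) (fun i _ => hY.memLp hinv hg2 i),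
    sum_sum_eq_sum_lags _ (fun i j => covariance_comm _ _) γ hcov, tau, Finset.mul_sum,
    Finset.mul_sum, Finset.mul_sum]
  refine Finset.sum_congr rfl fun t _ => ?_
  rw [hcorr]
  field_simp

/-- By the spectral gap the lag-`t` correlation is at most `ρ ^ |t|` whatever `h` and `x` are, and
the weights are at most `1`; a geometric series gives a bound uniform in `n`, `h` and `x`. -/
lemma IsMarkovChain.abs_tau_le (hY : IsMarkovChain μ Y P π) (hgeo : GeometricallyErgodic P π)
    (hrev : P.IsReversible π) (hK : Measurable K) :
    ∃ C, 0 ≤ C ∧ ∀ (n : ℕ) (h x : ℝ), MemLp (fun y : S => scaled K h (x - y)) 2 π →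
      |tau μ K (fun i ω => (Y i ω : ℝ)) n h x| ≤ C := by
  have : IsProbabilityMeasure π := by
    rw [← hY.initial]
    exact Measure.isProbabilityMeasure_map (hY.measurable 0).aemeasurable
  have hinv := hrev.invariant
  obtain ⟨ρ, hρ0, hρ1, hgap⟩ := hgeo.abs_autocovariance_le hrev
  refine ⟨2 / (1 - ρ), div_nonneg zero_le_two (by linarith), fun n h x hg2 => ?_⟩
  set g : S → ℝ := fun y => scaled K h (x - y) with hgdef
  have hg : Measurable g := (measurable_scaled_sub hK h x).comp measurable_subtype_coe
  have hcov := hY.covariance_eq hinv hg hg2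
  have hvar := hY.variance_eq hinv hg hg2
  have hV0 : 0 ≤ ∫ y, g y ^ 2 ∂π - (∫ y, g y ∂π) ^ 2 := by
    rw [← hvar 0]
    exact variance_nonneg _ _
  have hcorr : ∀ t : ℕ, |corr μ (fun ω => scaled K h (x - Y 0 ω))
      (fun ω => scaled K h (x - Y t ω))| ≤ ρ ^ t := fun t => by
    have hc := hcov 0 t
    rw [zero_add] at hc
    rw [corr, hvar t, hvar 0, hc, Real.mul_self_sqrt hV0, abs_div, abs_of_nonneg hV0]
    exact div_le_of_le_mul₀ hV0 (by positivity) (hgap g hg hg2.integrable_sq t)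
  refine (Finset.abs_sum_le_sum_abs _ _).trans ?_
  refine (Finset.sum_le_sum fun t ht => ?_).trans (sum_Ioo_pow_natAbs_le hρ0.le hρ1 n)
  rw [abs_mul]
  have ht1 : |(1 : ℝ) - |(t : ℝ)| / (n : ℝ)| ≤ 1 := by
    have ht2 : |(t : ℝ)| ≤ n := by
      rw [Finset.mem_Ioo] at ht
      exact abs_le.2 ⟨by exact_mod_cast ht.1.le, by exact_mod_cast ht.2.le⟩
    have ht3 : |(t : ℝ)| / n ≤ 1 := div_le_one_of_le₀ ht2 (by positivity)
    have ht4 : 0 ≤ |(t : ℝ)| / n := by positivity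
    exact abs_le.2 ⟨by linarith, by linarith⟩
  exact (mul_le_mul ht1 (hcorr _) (abs_nonneg _) zero_le_one).trans_eq (one_mul _)

end EstimatorVariance

/-! ### Taylor remainders, pointwise and in `L¹`. -/

section Remainders

lemma eq_intervalIntegral_of_hasDerivAt {F G : ℝ → ℝ} (h0 : F 0 = 0)
    (hd : ∀ v, HasDerivAt F (G v) v) (hG : Continuous G) (v : ℝ) : F v = ∫ w in (0 : ℝ)..v, G w := by
  rw [intervalIntegral.integral_eq_sub_of_hasDerivAt (fun w _ => hd w) (hG.intervalIntegrable _ _),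
    h0, sub_zero]

lemma abs_le_mul_pow_succ_of_hasDerivAt {F G : ℝ → ℝ} (h0 : F 0 = 0)
    (hd : ∀ v, HasDerivAt F (G v) v) (hG : Continuous G) {C : ℝ} {k : ℕ}
    (hC : ∀ w, |G w| ≤ C * |w| ^ k) (v : ℝ) : |F v| ≤ C * |v| ^ (k + 1) := by
  have hC0 : 0 ≤ C := by simpa using (abs_nonneg _).trans (hC 1)
  rw [eq_intervalIntegral_of_hasDerivAt h0 hd hG, ← Real.norm_eq_abs]
  refine (intervalIntegral.norm_integral_le_of_norm_le_const (C := C * |v| ^ k)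
    fun w hw => (hC w).trans ?_).trans_eq ?_
  · have : |w| ≤ |v| := by
      rcases le_total 0 v with h | h
      · rw [Set.uIoc_of_le h] at hw
        rw [abs_of_nonneg h, abs_of_pos hw.1]
        exact hw.2
      · rw [Set.uIoc_of_ge h] at hw
        rw [abs_of_nonpos h, abs_of_nonpos hw.2]
        linarith [hw.1]
    gcongr
  · rw [sub_zero]
    ring

/-- Write `F x v` as the integral of `G x` from `0` to `v` and exchange the integrals by Tonelli.
Each integration gains one power of `v`; the factor `1 / (k + 1)` is given away. -/
lemma lintegral_enorm_le_mul_pow_succ_of_hasDerivAt {F G : ℝ → ℝ → ℝ} (h0 : ∀ x, F x 0 = 0)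
    (hd : ∀ x v, HasDerivAt (F x) (G x v) v) (hG : Continuous (Function.uncurry G))
    {C : ENNReal} {k : ℕ} (hC : ∀ w, ∫⁻ x, ‖G x w‖ₑ ≤ C * ‖w‖ₑ ^ k) (v : ℝ) :
    ∫⁻ x, ‖F x v‖ₑ ≤ C * ‖v‖ₑ ^ (k + 1) := by
  have hGx : ∀ x, Continuous (G x) := fun x => hG.comp (Continuous.prodMk_right x)
  have hvol : volume (Set.uIoc 0 v) = ‖v‖ₑ := by
    rw [Set.uIoc, Real.volume_Ioc, max_sub_min_eq_abs, sub_zero, Real.enorm_eq_ofReal_abs]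
  calc ∫⁻ x, ‖F x v‖ₑ ≤ ∫⁻ x, ∫⁻ w in Set.uIoc 0 v, ‖G x w‖ₑ := lintegral_mono fun x => by
        rw [eq_intervalIntegral_of_hasDerivAt (h0 x) (hd x) (hGx x), ← enorm_norm,
          intervalIntegral.norm_integral_eq_norm_integral_uIoc, enorm_norm]
        exact enorm_integral_le_lintegral_enorm _
    _ = ∫⁻ w in Set.uIoc 0 v, ∫⁻ x, ‖G x w‖ₑ :=
        lintegral_lintegral_swap hG.measurable.enorm.aemeasurable
    _ ≤ ∫⁻ w in Set.uIoc 0 v, C * ‖v‖ₑ ^ k := by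
        refine setLIntegral_mono measurable_const fun w hw => (hC w).trans ?_
        have : ‖w‖ₑ ≤ ‖v‖ₑ := by
          rw [Real.enorm_eq_ofReal_abs, Real.enorm_eq_ofReal_abs]
          refine ENNReal.ofReal_le_ofReal ?_
          rcases le_total 0 v with h | h
          · rw [Set.uIoc_of_le h] at hw
            rw [abs_of_nonneg h, abs_of_pos hw.1]
            exact hw.2
          · rw [Set.uIoc_of_ge h] at hw
            rw [abs_of_nonpos h, abs_of_nonpos hw.2]
            linarith [hw.1]
        gcongr
    _ = C * ‖v‖ₑ ^ (k + 1) := by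
        rw [setLIntegral_const, hvol, pow_succ, mul_assoc]

lemma exists_bound_of_integrable_deriv {g g' : ℝ → ℝ} (hd : ∀ x, HasDerivAt g (g' x) x)
    (hc : Continuous g') (hi : Integrable g') : ∃ B, 0 ≤ B ∧ ∀ x, |g x| ≤ B := by
  refine ⟨|g 0| + ∫ x, |g' x|, by positivity, fun x => ?_⟩
  have h := intervalIntegral.integral_eq_sub_of_hasDerivAt (fun w _ => hd w)
    (hc.intervalIntegrable 0 x)
  have h2 : |g x - g 0| ≤ ∫ x, |g' x| := by
    rw [← h, ← Real.norm_eq_abs, intervalIntegral.norm_integral_eq_norm_integral_uIoc]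
    exact (norm_integral_le_integral_norm _).trans
      (setIntegral_le_integral hi.norm (ae_of_all _ fun _ => norm_nonneg _))
  have h3 := abs_add_le (g 0) (g x - g 0)
  rw [add_sub_cancel] at h3
  linarith

variable {g g₁ g₂ g₃ : ℝ → ℝ}

lemma hasDerivAt_comp_sub (hd : ∀ x, HasDerivAt g (g₁ x) x) (x v : ℝ) :
    HasDerivAt (fun v => g (x - v)) (-g₁ (x - v)) v := by
  refine ((hd (x - v)).comp v ((hasDerivAt_id v).const_sub x)).congr_deriv ?_
  ring

/-- In this and the next two lemmas, the `v`-derivative of a Taylor remainder of `g` is minus the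
remainder of `g₁` of one order less. This lets the bounds climb one order per integration, starting
from translation invariance. -/
lemma hasDerivAt_remainder_one (hd : ∀ x, HasDerivAt g (g₁ x) x) (x v : ℝ) :
    HasDerivAt (fun v => g (x - v) - g x) (-g₁ (x - v)) v :=
  (hasDerivAt_comp_sub hd x v).sub_const _

lemma hasDerivAt_remainder_two (hd : ∀ x, HasDerivAt g (g₁ x) x) (x v : ℝ) :
    HasDerivAt (fun v => g (x - v) - g x + v * g₁ x) (-(g₁ (x - v) - g₁ x)) v := by
  refine ((hasDerivAt_remainder_one hd x v).add ((hasDerivAt_id v).mul_const (g₁ x))).congr_deriv ?_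
  ring

lemma hasDerivAt_remainder_three (hd : ∀ x, HasDerivAt g (g₁ x) x) (x v : ℝ) :
    HasDerivAt (fun v => g (x - v) - g x + v * g₁ x - v ^ 2 / 2 * g₂ x)
      (-(g₁ (x - v) - g₁ x + v * g₂ x)) v := by
  refine ((hasDerivAt_remainder_two hd x v).sub
    ((((hasDerivAt_id v).pow 2).div_const 2).mul_const (g₂ x))).congr_deriv ?_
  simp
  ring

lemma lintegral_remainder_one_le (hd : ∀ x, HasDerivAt g (g₁ x) x) (hc : Continuous g₁) (v : ℝ) :
    ∫⁻ x, ‖g (x - v) - g x‖ₑ ≤ (∫⁻ x, ‖g₁ x‖ₑ) * ‖v‖ₑ ^ 1 := by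
  refine lintegral_enorm_le_mul_pow_succ_of_hasDerivAt (F := fun x v => g (x - v) - g x)
    (G := fun x v => -g₁ (x - v)) (by simp) (hasDerivAt_remainder_one hd) (by fun_prop) ?_ v
  intro w
  simp only [enorm_neg, pow_zero, mul_one]
  rw [lintegral_sub_right_eq_self (fun x => ‖g₁ x‖ₑ)]

lemma lintegral_remainder_two_le (hd : ∀ x, HasDerivAt g (g₁ x) x)
    (hd₁ : ∀ x, HasDerivAt g₁ (g₂ x) x) (hc₁ : Continuous g₁) (hc₂ : Continuous g₂) (v : ℝ) :
    ∫⁻ x, ‖g (x - v) - g x + v * g₁ x‖ₑ ≤ (∫⁻ x, ‖g₂ x‖ₑ) * ‖v‖ₑ ^ 2 := by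
  refine lintegral_enorm_le_mul_pow_succ_of_hasDerivAt
    (F := fun x v => g (x - v) - g x + v * g₁ x)
    (G := fun x v => -(g₁ (x - v) - g₁ x)) (by simp) (hasDerivAt_remainder_two hd) (by fun_prop) ?_ v
  intro w
  simp only [enorm_neg]
  exact lintegral_remainder_one_le hd₁ hc₂ w

lemma lintegral_remainder_three_le (hd : ∀ x, HasDerivAt g (g₁ x) x)
    (hd₁ : ∀ x, HasDerivAt g₁ (g₂ x) x) (hd₂ : ∀ x, HasDerivAt g₂ (g₃ x) x)
    (hc₁ : Continuous g₁) (hc₂ : Continuous g₂) (hc₃ : Continuous g₃) (v : ℝ) :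
    ∫⁻ x, ‖g (x - v) - g x + v * g₁ x - v ^ 2 / 2 * g₂ x‖ₑ ≤ (∫⁻ x, ‖g₃ x‖ₑ) * ‖v‖ₑ ^ 3 := by
  refine lintegral_enorm_le_mul_pow_succ_of_hasDerivAt
    (F := fun x v => g (x - v) - g x + v * g₁ x - v ^ 2 / 2 * g₂ x)
    (G := fun x v => -(g₁ (x - v) - g₁ x + v * g₂ x)) (by simp) (hasDerivAt_remainder_three hd)
    (by fun_prop) ?_ v
  intro w
  simp only [enorm_neg]
  exact lintegral_remainder_two_le hd₁ hd₂ hc₂ hc₃ w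

lemma abs_remainder_two_le (hd : ∀ x, HasDerivAt g (g₁ x) x)
    (hd₁ : ∀ x, HasDerivAt g₁ (g₂ x) x) (hc₁ : Continuous g₁) (hc₂ : Continuous g₂) {B : ℝ}
    (hB : ∀ x, |g₂ x| ≤ B) (x v : ℝ) : |g (x - v) - g x + v * g₁ x| ≤ B * |v| ^ 2 := by
  refine abs_le_mul_pow_succ_of_hasDerivAt (F := fun v => g (x - v) - g x + v * g₁ x)
    (G := fun v => -(g₁ (x - v) - g₁ x)) (by simp) (hasDerivAt_remainder_two hd x) (by fun_prop) ?_ v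
  intro w
  rw [abs_neg]
  refine abs_le_mul_pow_succ_of_hasDerivAt (F := fun v => g₁ (x - v) - g₁ x)
    (G := fun v => -g₂ (x - v)) (by simp) (hasDerivAt_remainder_one hd₁ x) (by fun_prop) ?_ w
  intro w
  simpa using hB _

end Remainders

/-! ### Convolution with a rescaled kernel. -/

section Smoothing

lemma measurable_integral_mul_comp {Q : ℝ → ℝ} (hQ : Measurable Q) {F : ℝ → ℝ → ℝ}
    (hF : Measurable (Function.uncurry F)) (h : ℝ) :
    Measurable fun x => ∫ u, Q u * F x (h * u) := by
  have hm : Measurable fun p : ℝ × ℝ => Q p.2 * F p.1 (h * p.2) :=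
    (hQ.comp measurable_snd).mul (hF.comp (measurable_fst.prodMk (measurable_snd.const_mul h)))
  exact (hm.stronglyMeasurable.integral_prod_right (ν := volume)).measurable

/-- Averaging against a kernel with a `k`-th moment a family of functions whose `L¹` norm is at
most a multiple of the `k`-th power of the parameter. -/
lemma integral_abs_integral_mul_comp_le {Q : ℝ → ℝ} (hQ : Measurable Q) {F : ℝ → ℝ → ℝ}
    (hF : Measurable (Function.uncurry F)) {C : ℝ} (hC0 : 0 ≤ C) {k : ℕ}
    (hC : ∀ v, ∫⁻ x, ‖F x v‖ₑ ≤ ENNReal.ofReal C * ‖v‖ₑ ^ k)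
    (hD : Integrable fun u => |u| ^ k * Q u) {h : ℝ} (hh : 0 < h) :
    Integrable (fun x => ∫ u, Q u * F x (h * u)) ∧
      ∫ x, |∫ u, Q u * F x (h * u)| ≤ C * h ^ k * ∫ u, |(|u| ^ k * Q u)| := by
  have hm : Measurable fun p : ℝ × ℝ => Q p.2 * F p.1 (h * p.2) :=
    (hQ.comp measurable_snd).mul (hF.comp (measurable_fst.prodMk (measurable_snd.const_mul h)))
  have hD0 : 0 ≤ ∫ u, |(|u| ^ k * Q u)| := integral_nonneg fun _ => abs_nonneg _
  have hmeas := measurable_integral_mul_comp hQ hF h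
  -- Working with `lintegral` lets Tonelli yield integrability and the bound at once.
  have key : ∫⁻ x, ‖∫ u, Q u * F x (h * u)‖ₑ
      ≤ ENNReal.ofReal (C * h ^ k * ∫ u, |(|u| ^ k * Q u)|) := by
    calc ∫⁻ x, ‖∫ u, Q u * F x (h * u)‖ₑ ≤ ∫⁻ x, ∫⁻ u, ‖Q u * F x (h * u)‖ₑ :=
          lintegral_mono fun x => enorm_integral_le_lintegral_enorm _
      _ = ∫⁻ u, ∫⁻ x, ‖Q u * F x (h * u)‖ₑ := lintegral_lintegral_swap hm.enorm.aemeasurable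
      _ ≤ ∫⁻ u, ENNReal.ofReal (C * h ^ k) * ‖|u| ^ k * Q u‖ₑ := lintegral_mono fun u => by
          simp_rw [enorm_mul]
          rw [lintegral_const_mul' _ _ enorm_ne_top]
          calc ‖Q u‖ₑ * ∫⁻ x, ‖F x (h * u)‖ₑ
              ≤ ‖Q u‖ₑ * (ENNReal.ofReal C * ‖h * u‖ₑ ^ k) := by gcongr; exact hC _
            _ = ENNReal.ofReal (C * h ^ k) * (‖|u| ^ k‖ₑ * ‖Q u‖ₑ) := by
                rw [enorm_mul, mul_pow, ENNReal.ofReal_mul hC0, enorm_pow, Real.enorm_abs,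
                  ENNReal.ofReal_pow hh.le, Real.enorm_eq_ofReal hh.le]
                ring
      _ = ENNReal.ofReal (C * h ^ k * ∫ u, |(|u| ^ k * Q u)|) := by
          rw [lintegral_const_mul' _ _ ENNReal.ofReal_ne_top,
            ENNReal.ofReal_mul (p := C * h ^ k) (by positivity)]
          congr 1
          exact (ofReal_integral_norm_eq_lintegral_enorm hD).symm
  have hint : Integrable (fun x => ∫ u, Q u * F x (h * u)) :=
    ⟨hmeas.aestronglyMeasurable, key.trans_lt ENNReal.ofReal_lt_top⟩
  refine ⟨hint, ?_⟩
  rw [← ENNReal.ofReal_le_ofReal_iff (by positivity)]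
  refine le_trans (le_of_eq ?_) key
  exact ofReal_integral_norm_eq_lintegral_enorm hint

lemma integrable_mul_comp_sub {Q F : ℝ → ℝ} (hQ : Integrable Q) (hF : Measurable F) {B : ℝ}
    (hB : ∀ x, |F x| ≤ B) (h x : ℝ) : Integrable fun u => Q u * F (x - h * u) :=
  hQ.mul_bdd (c := B) (hF.comp (by fun_prop)).aestronglyMeasurable
    (ae_of_all _ fun u => hB _)

/-- The substitution `y = x - h u` in a convolution with a rescaled kernel. -/
lemma integral_comp_div_mul (Q F : ℝ → ℝ) {h : ℝ} (hh : 0 < h) (x : ℝ) :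
    ∫ y, Q ((x - y) / h) * F y = h * ∫ u, Q u * F (x - h * u) := by
  have h1 := integral_sub_left_eq_self (fun y => Q ((x - y) / h) * F y) volume x
  rw [← h1]
  have h2 := Measure.integral_comp_mul_left (fun v => Q (v / h) * F (x - v)) h
  simp only [mul_div_cancel_left₀ _ hh.ne'] at h2
  rw [h2, abs_of_pos (inv_pos.2 hh)]
  simp [hh.ne']

lemma integrable_comp_div_mul {Q F : ℝ → ℝ} (hQ : Integrable Q) (hF : Measurable F) {B : ℝ}
    (hB : ∀ x, |F x| ≤ B) {h : ℝ} (hh : 0 < h) (x : ℝ) :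
    Integrable fun y => Q ((x - y) / h) * F y :=
  ((hQ.comp_div hh.ne').comp_sub_left x).mul_bdd (c := B) hF.aestronglyMeasurable
    (ae_of_all _ hB)

/-- For bounded `|t|` compare with `K ^ 2`. Far out, `|t| ^ 2 * K t ≤ 1` and `|t| ≥ 1` give `|t| * K
t ≤ 1`, so the integrand is at most `K`. -/
lemma integrable_abs_mul_sq {K : ℝ → ℝ} (hm : Measurable K) (h0 : ∀ t, 0 ≤ K t)
    (hi : Integrable K) (h2 : Integrable fun t => K t ^ 2)
    (ht : Tendsto (fun t => |t| ^ 2 * K t) (cocompact ℝ) (𝓝 0)) :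
    Integrable fun t => |t| ^ 1 * K t ^ 2 := by
  have hev : ∀ᶠ t in cocompact ℝ, |t| ^ 2 * K t ≤ 1 :=
    (ht.eventually (gt_mem_nhds zero_lt_one)).mono fun t h => h.le
  obtain ⟨s, hs, hsub⟩ := Filter.mem_cocompact.1 hev
  obtain ⟨T, hT⟩ := hs.isBounded.exists_norm_le
  refine ((h2.const_mul (max T 1)).add hi).mono'
    ((measurable_id.norm.pow_const 1).mul (hm.pow_const 2)).aestronglyMeasurable
    (ae_of_all _ fun t => ?_)
  have hK := h0 t
  rw [Real.norm_of_nonneg (by positivity), pow_one]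
  simp only [Pi.add_apply]
  by_cases hle : |t| ≤ max T 1
  · have : |t| * K t ^ 2 ≤ max T 1 * K t ^ 2 := by gcongr
    linarith
  · push Not at hle
    have hts : t ∉ s := fun h => absurd ((hT t h).trans (le_max_left T 1)) (not_le.2 hle)
    have h1 : |t| ^ 2 * K t ≤ 1 := hsub hts
    have ht1 : 1 ≤ |t| := (le_max_right T 1).trans hle.le
    have h3 : |t| * K t ≤ 1 := by nlinarith [mul_nonneg (abs_nonneg t) hK]
    have h4 : |t| * K t ^ 2 ≤ K t := by nlinarith
    have h5 : 0 ≤ max T 1 * K t ^ 2 := by positivity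
    linarith

end Smoothing

/-! ### Pointwise expansion of the bias. -/

section Bias

variable {K g g₁ g₂ g₃ : ℝ → ℝ}

/-- The pointwise Taylor expansion of the bias. -/
lemma bias_eq (hK : Integrable K) (hK1 : ∫ u, K u = 1) (hKm : ∫ u, u * K u = 0)
    (hKi : Integrable fun u => u * K u) (hK2 : Integrable fun u => u ^ 2 * K u)
    (hg : Measurable g) {B : ℝ} (hB : ∀ x, |g x| ≤ B) (h x : ℝ) :
    (∫ u, K u * g (x - h * u)) - g x = h ^ 2 / 2 * secondMoment K * g₂ x
      + ∫ u, K u * (g (x - h * u) - g x + (h * u) * g₁ x - (h * u) ^ 2 / 2 * g₂ x) := by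
  -- The identity is algebraic in `g₁ x` and `g₂ x`: the first-order term integrates to zero by the
  -- mean of `K`, and the second-order one gives the second moment.
  have e : ∀ u, K u * (g (x - h * u) - g x + (h * u) * g₁ x - (h * u) ^ 2 / 2 * g₂ x)
      = ((K u * g (x - h * u) - g x * K u) + (h * g₁ x) * (u * K u))
        - (h ^ 2 / 2 * g₂ x) * (u ^ 2 * K u) := fun u => by ring
  simp_rw [e]
  have i1 := integrable_mul_comp_sub hK hg hB h x
  have i2 := hK.const_mul (g x)
  have i3 := hKi.const_mul (h * g₁ x)
  have i4 := hK2.const_mul (h ^ 2 / 2 * g₂ x)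
  rw [integral_sub (by exact (i1.sub i2).add i3) i4, integral_add (by exact i1.sub i2) i3,
    integral_sub i1 i2, integral_const_mul, integral_const_mul, integral_const_mul, hK1, hKm,
    secondMoment]
  ring

/-- Only order `h ^ 2`, but uniform in `x`: it controls the bounded factor in the squared bias,
while the other factor is estimated to third order in `L¹`. -/
lemma abs_bias_remainder_le (hK0 : ∀ u, 0 ≤ K u) (hK2 : Integrable fun u => u ^ 2 * K u)
    (hd : ∀ x, HasDerivAt g (g₁ x) x) (hd₁ : ∀ x, HasDerivAt g₁ (g₂ x) x)
    (hc₁ : Continuous g₁) (hc₂ : Continuous g₂) {B : ℝ} (hB : ∀ x, |g₂ x| ≤ B) (h x : ℝ) :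
    |∫ u, K u * (g (x - h * u) - g x + (h * u) * g₁ x - (h * u) ^ 2 / 2 * g₂ x)|
      ≤ 2 * B * h ^ 2 * secondMoment K := by
  rw [secondMoment, ← integral_const_mul, ← Real.norm_eq_abs]
  refine norm_integral_le_of_norm_le (hK2.const_mul _) (ae_of_all _ fun u => ?_)
  have h1 := abs_remainder_two_le hd hd₁ hc₁ hc₂ hB x (h * u)
  rw [sq_abs] at h1
  have h2 := hB x
  have h3 : |(h * u) ^ 2 / 2 * g₂ x| ≤ (h * u) ^ 2 / 2 * B := by
    rw [abs_mul, abs_of_nonneg (by positivity)]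
    gcongr
  have hB0 : 0 ≤ B := (abs_nonneg _).trans h2
  rw [norm_mul, Real.norm_of_nonneg (hK0 u)]
  have h4 : ‖g (x - h * u) - g x + (h * u) * g₁ x - (h * u) ^ 2 / 2 * g₂ x‖
      ≤ 2 * B * (h * u) ^ 2 := by
    refine (abs_sub _ _).trans ?_
    have : 0 ≤ B * (h * u) ^ 2 := by positivity
    linarith
  calc K u * _ ≤ K u * (2 * B * (h * u) ^ 2) := mul_le_mul_of_nonneg_left h4 (hK0 u)
    _ = _ := by ring

end Bias

/-! ### Integrals against the stationary law. -/

section DensityMeasure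

variable {f : ℝ → ℝ} {S : Set ℝ}

/-- Pulling back to `S` and pushing forward restricts to `S`, which loses nothing because `f`
vanishes almost everywhere off `S`. -/
lemma map_densityMeasure (hS : MeasurableSet S) (hfm : Measurable f) (hf : IsDensityOn f S) :
    (densityMeasure f S).map Subtype.val
      = volume.withDensity fun x => ENNReal.ofReal (f x) := by
  rw [densityMeasure, (MeasurableEmbedding.subtype_coe hS).map_comap, Subtype.range_coe]
  refine Measure.restrict_eq_self_of_ae_mem ?_
  rw [ae_withDensity_iff hfm.ennreal_ofReal]
  filter_upwards [hf.ae_zero_off] with x hx h0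
  by_contra hxS
  exact h0 (by rw [hx hxS, ENNReal.ofReal_zero])

lemma integral_densityMeasure (hS : MeasurableSet S) (hfm : Measurable f) (hf : IsDensityOn f S)
    {φ : ℝ → ℝ} (hφ : Measurable φ) :
    ∫ y : S, φ y ∂densityMeasure f S = ∫ y, φ y * f y := by
  rw [← integral_map measurable_subtype_coe.aemeasurable hφ.aestronglyMeasurable,
    map_densityMeasure hS hfm hf, integral_withDensity_eq_integral_toReal_smul
      hfm.ennreal_ofReal (ae_of_all _ fun _ => ENNReal.ofReal_lt_top)]
  refine integral_congr_ae (ae_of_all _ fun y => ?_)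
  simp only [ENNReal.toReal_ofReal (hf.nonneg y), smul_eq_mul]
  ring

lemma memLp_densityMeasure (hS : MeasurableSet S) (hfm : Measurable f) (hf : IsDensityOn f S)
    {φ : ℝ → ℝ} (hφ : Measurable φ) (hi : Integrable fun y => φ y ^ 2 * f y) :
    MemLp (fun y : S => φ y) 2 (densityMeasure f S) := by
  have h : MemLp φ 2 ((densityMeasure f S).map Subtype.val) := by
    rw [memLp_two_iff_integrable_sq hφ.aestronglyMeasurable, map_densityMeasure hS hfm hf,
      integrable_withDensity_iff_integrable_smul' hfm.ennreal_ofReal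
        (ae_of_all _ fun _ => ENNReal.ofReal_lt_top)]
    refine hi.congr (ae_of_all _ fun y => ?_)
    simp only [ENNReal.toReal_ofReal (hf.nonneg y), smul_eq_mul]
    ring
  exact (memLp_map_measure_iff hφ.aestronglyMeasurable measurable_subtype_coe.aemeasurable).1 h

variable {K : ℝ → ℝ} {B h : ℝ}

lemma integral_scaled_densityMeasure (hS : MeasurableSet S) (hfm : Measurable f)
    (hf : IsDensityOn f S) (hK : Measurable K) (hh : 0 < h) (x : ℝ) :
    ∫ y : S, scaled K h (x - y) ∂densityMeasure f S = ∫ u, K u * f (x - h * u) := by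
  rw [integral_densityMeasure hS hfm hf (measurable_scaled_sub hK h x)]
  have : ∀ y, scaled K h (x - y) * f y = h⁻¹ * (K ((x - y) / h) * f y) := fun y => by
    rw [scaled]
    ring
  simp_rw [this]
  rw [integral_const_mul, integral_comp_div_mul K f hh, inv_mul_cancel_left₀ hh.ne']

lemma integral_scaled_sq_densityMeasure (hS : MeasurableSet S) (hfm : Measurable f)
    (hf : IsDensityOn f S) (hK : Measurable K) (hh : 0 < h) (x : ℝ) :
    ∫ y : S, scaled K h (x - y) ^ 2 ∂densityMeasure f S
      = h⁻¹ * ∫ u, K u ^ 2 * f (x - h * u) := by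
  rw [integral_densityMeasure hS hfm hf ((measurable_scaled_sub hK h x).pow_const 2)]
  have : ∀ y, scaled K h (x - y) ^ 2 * f y = h⁻¹ * h⁻¹ * (K ((x - y) / h) ^ 2 * f y) := fun y => by
    rw [scaled]
    ring
  simp_rw [this]
  rw [integral_const_mul, integral_comp_div_mul (fun u => K u ^ 2) f hh, mul_assoc,
    inv_mul_cancel_left₀ hh.ne']

lemma memLp_scaled_densityMeasure (hS : MeasurableSet S) (hfm : Measurable f)
    (hf : IsDensityOn f S) (hB : ∀ x, |f x| ≤ B) (hK : Measurable K)
    (hRK : Integrable fun t => K t ^ 2) (hh : 0 < h) (x : ℝ) :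
    MemLp (fun y : S => scaled K h (x - y)) 2 (densityMeasure f S) := by
  refine memLp_densityMeasure hS hfm hf (measurable_scaled_sub hK h x) ?_
  refine ((integrable_comp_div_mul hRK hfm hB hh x).const_mul (h⁻¹ * h⁻¹)).congr
    (ae_of_all _ fun y => ?_)
  simp only [scaled]
  ring

end DensityMeasure

/-! ### Measurability in `x` and joint square integrability. -/

section Measurability

lemma measurable_covariance {Ω : Type*} [MeasurableSpace Ω] {μ : Measure Ω} [SFinite μ]
    {U V : ℝ → Ω → ℝ} (hU : Measurable (Function.uncurry U)) (hV : Measurable (Function.uncurry V)) :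
    Measurable fun x => cov[U x, V x; μ] := by
  have hUm : Measurable fun x => ∫ ω, U x ω ∂μ :=
    (hU.stronglyMeasurable.integral_prod_right (ν := μ)).measurable
  have hVm : Measurable fun x => ∫ ω, V x ω ∂μ :=
    (hV.stronglyMeasurable.integral_prod_right (ν := μ)).measurable
  have : Measurable fun p : ℝ × Ω => (U p.1 p.2 - ∫ ω, U p.1 ω ∂μ) * (V p.1 p.2 - ∫ ω, V p.1 ω ∂μ) :=
    (hU.sub (hUm.comp measurable_fst)).mul (hV.sub (hVm.comp measurable_fst))
  exact (this.stronglyMeasurable.integral_prod_right' (ν := μ)).measurable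

lemma measurable_corr {Ω : Type*} [MeasurableSpace Ω] {μ : Measure Ω} [SFinite μ]
    {U V : ℝ → Ω → ℝ} (hU : Measurable (Function.uncurry U)) (hV : Measurable (Function.uncurry V)) :
    Measurable fun x => corr μ (U x) (V x) := by
  unfold corr
  -- Variances are rewritten as covariances, for which joint measurability of the integrand
  -- suffices.
  simp_rw [fun x => (covariance_self (μ := μ) (hU.comp (measurable_prodMk_left (x := x))).aemeasurable
    : cov[U x, U x; μ] = Var[U x; μ]).symm, fun x => (covariance_self (μ := μ)
      (hV.comp (measurable_prodMk_left (x := x))).aemeasurable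
      : cov[V x, V x; μ] = Var[V x; μ]).symm]
  exact (measurable_covariance hU hV).div
    ((measurable_covariance hU hU).sqrt.mul (measurable_covariance hV hV).sqrt)

variable {Ω : Type*} [MeasurableSpace Ω] {K : ℝ → ℝ} {Y : ℕ → Ω → ℝ}

lemma measurable_uncurry_scaled (hK : Measurable K) (hY : ∀ i, Measurable (Y i)) (h : ℝ) (i : ℕ) :
    Measurable (Function.uncurry fun x ω => scaled K h (x - Y i ω)) := by
  have := hY i
  unfold scaled Function.uncurry
  fun_prop

lemma measurable_tau {μ : Measure Ω} [SFinite μ] (hK : Measurable K) (hY : ∀ i, Measurable (Y i))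
    (n : ℕ) (h : ℝ) : Measurable (tau μ K Y n h) := by
  unfold tau
  exact Finset.measurable_sum _ fun t _ => (measurable_corr (measurable_uncurry_scaled hK hY h 0)
    (measurable_uncurry_scaled hK hY h _)).const_mul _

/-- By translation invariance the integral over `x` of the squared kernel does not depend on `ω`. -/
lemma memLp_uncurry_scaled {μ : Measure Ω} [IsFiniteMeasure μ] (hK : Measurable K)
    (hRK : Integrable fun t => K t ^ 2) (hY : ∀ i, Measurable (Y i)) (h : ℝ) (hh : 0 < h) (i : ℕ) :
    MemLp (fun p : ℝ × Ω => scaled K h (p.1 - Y i p.2)) 2 (volume.prod μ) := by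
  have hm := measurable_uncurry_scaled hK hY h i
  refine (memLp_two_iff_integrable_sq hm.aestronglyMeasurable).2 ?_
  rw [integrable_prod_iff' (by exact (hm.pow_const 2).aestronglyMeasurable)]
  have hint : Integrable fun v => scaled K h v ^ 2 := by
    simp_rw [scaled, div_pow]
    exact (hRK.comp_div hh.ne').div_const _
  constructor
  · exact ae_of_all _ fun ω => hint.comp_sub_right (Y i ω)
  · have : ∀ ω, ∫ x, ‖scaled K h (x - Y i ω) ^ 2‖ = ∫ x, ‖scaled K h x ^ 2‖ := fun ω =>
      integral_sub_right_eq_self (fun x => ‖scaled K h x ^ 2‖) (Y i ω)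
    simp only [Function.uncurry]
    simp_rw [this]
    exact integrable_const _

lemma memLp_uncurry_kde {μ : Measure Ω} [IsFiniteMeasure μ] (hK : Measurable K)
    (hRK : Integrable fun t => K t ^ 2) (hY : ∀ i, Measurable (Y i)) (n : ℕ) {h : ℝ} (hh : 0 < h) :
    MemLp (fun p : ℝ × Ω => kde K Y n h p.1 p.2) 2 (volume.prod μ) := by
  have hsum : MemLp (fun p : ℝ × Ω => ∑ i ∈ Finset.range n, scaled K h (p.1 - Y i p.2)) 2
      (volume.prod μ) := by
    refine memLp_finsetSum (f := fun i (p : ℝ × Ω) => scaled K h (p.1 - Y i p.2)) _ fun i _ => ?_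
    exact memLp_uncurry_scaled hK hRK hY h hh i
  have hkde : (fun p : ℝ × Ω => kde K Y n h p.1 p.2)
      = fun p => (1 / (n : ℝ)) * ∑ i ∈ Finset.range n, scaled K h (p.1 - Y i p.2) :=
    funext fun p => kde_eq_sum_scaled K Y n h p.1 p.2
  rw [hkde]
  exact hsum.const_mul (1 / (n : ℝ))

end Measurability

section Derivatives

lemma hasDerivAt_iteratedDeriv {f : ℝ → ℝ} {n k : ℕ} (hf : ContDiff ℝ n f) (hk : k < n) (x : ℝ) :
    HasDerivAt (iteratedDeriv k f) (iteratedDeriv (k + 1) f x) x := by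
  rw [iteratedDeriv_succ]
  exact (hf.differentiable_iteratedDeriv k (by exact_mod_cast hk) x).hasDerivAt

end Derivatives

/-! ### Variance–bias decomposition. -/

section Expansion

variable {K f : ℝ → ℝ} {S : Set ℝ} {P : Kernel S S} [IsMarkovKernel P] {Ω : Type*}
  [MeasurableSpace Ω] {μ : Measure Ω} [IsProbabilityMeasure μ] {Y : ℕ → Ω → S} {B h : ℝ}

/-- The pointwise decomposition of the mean squared error into variance and squared bias. -/
lemma integral_kde_sub_sq (hS : MeasurableSet S) (hfm : Measurable f) (hf : IsDensityOn f S)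
    (hB : ∀ x, |f x| ≤ B) (hK : Measurable K) (hRK : Integrable fun t => K t ^ 2)
    (hgeo : GeometricallyErgodic P (densityMeasure f S))
    (hrev : P.IsReversible (densityMeasure f S)) (hY : IsMarkovChain μ Y P (densityMeasure f S))
    {n : ℕ} (hn : 1 ≤ n) (hh : 0 < h) (x : ℝ) :
    ∫ ω, (kde K (fun i ω => (Y i ω : ℝ)) n h x ω - f x) ^ 2 ∂μ
      = 1 / n * (tau μ K (fun i ω => (Y i ω : ℝ)) n h x *
          (h⁻¹ * (∫ u, K u ^ 2 * f (x - h * u)) - (∫ u, K u * f (x - h * u)) ^ 2))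
        + ((∫ u, K u * f (x - h * u)) - f x) ^ 2 := by
  have hinv := hrev.invariant
  have hg : Measurable fun y : S => scaled K h (x - y) :=
    (measurable_scaled_sub hK h x).comp measurable_subtype_coe
  have hg2 := memLp_scaled_densityMeasure hS hfm hf hB hK hRK hh x
  have hvar := hY.variance_kde hgeo hrev hK n hn h x hg2
  rw [hY.variance_eq hinv hg hg2 0, integral_scaled_sq_densityMeasure hS hfm hf hK hh,
    integral_scaled_densityMeasure hS hfm hf hK hh] at hvar
  have hkde : kde K (fun i ω => (Y i ω : ℝ)) n h x
      = fun ω => (1 / (n : ℝ)) * ∑ i ∈ Finset.range n, scaled K h (x - Y i ω) := by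
    funext ω
    rw [kde_eq_sum_scaled]
  have hkL : MemLp (kde K (fun i ω => (Y i ω : ℝ)) n h x) 2 μ := by
    rw [hkde]
    exact (memLp_finsetSum (f := fun i ω => scaled K h (x - Y i ω)) (Finset.range n)
      fun i _ => hY.memLp hinv hg2 i).const_mul (1 / (n : ℝ))
  have hki : Integrable (kde K (fun i ω => (Y i ω : ℝ)) n h x) μ := hkL.integrable one_le_two
  have hn0 : (n : ℝ) ≠ 0 := by positivity
  have hmean : ∫ ω, kde K (fun i ω => (Y i ω : ℝ)) n h x ω ∂μ = ∫ u, K u * f (x - h * u) := by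
    rw [hkde, integral_const_mul,
      integral_finsetSum (f := fun i ω => scaled K h (x - Y i ω)) (Finset.range n)
        fun i _ => (hY.memLp hinv hg2 i).integrable one_le_two]
    have hi : ∀ i, ∫ ω, scaled K h (x - Y i ω) ∂μ = ∫ u, K u * f (x - h * u) := fun i =>
      (hY.integral_comp hinv hg i).trans (integral_scaled_densityMeasure hS hfm hf hK hh x)
    simp_rw [hi]
    rw [Finset.sum_const, Finset.card_range, nsmul_eq_mul, one_div, inv_mul_cancel_left₀ hn0]
  have hsub := variance_eq_sub (hkL.sub (memLp_const (f x)))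
  have hsub' : Var[kde K (fun i ω => (Y i ω : ℝ)) n h x - fun _ => f x; μ]
      = Var[kde K (fun i ω => (Y i ω : ℝ)) n h x; μ] := variance_sub_const hkL.1 _
  rw [hsub', hvar] at hsub
  simp only [Pi.sub_apply, Pi.pow_apply] at hsub
  rw [integral_sub hki (integrable_const _), hmean] at hsub
  simp only [integral_const, probReal_univ, one_smul] at hsub
  linarith

end Expansion

/-! ### The two deterministic `L¹` estimates. -/

section Deterministic

variable {K f : ℝ → ℝ} {B : ℝ}

/-- The error made on replacing the variance of a single rescaled kernel by `R(K) f / h` is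
bounded in `L¹`. -/
lemma integral_abs_variance_remainder_le (hK : IsSymmetricDensity K)
    (hRK : Integrable fun t => K t ^ 2) (hKw : Integrable fun t => |t| ^ 1 * K t ^ 2)
    {f₁ : ℝ → ℝ} (hfi : Integrable f) (hf₁i : Integrable f₁) (hfc : Continuous f)
    (hf₁c : Continuous f₁) (hd : ∀ x, HasDerivAt f (f₁ x) x) (hB : ∀ x, |f x| ≤ B) :
    ∃ C, 0 ≤ C ∧ ∀ h : ℝ, 0 < h →
      Integrable (fun x => h⁻¹ * (∫ u, K u ^ 2 * f (x - h * u)) - (∫ u, K u * f (x - h * u)) ^ 2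
        - h⁻¹ * R K * f x) ∧
      ∫ x, |h⁻¹ * (∫ u, K u ^ 2 * f (x - h * u)) - (∫ u, K u * f (x - h * u)) ^ 2
        - h⁻¹ * R K * f x| ≤ C := by
  have hB0 : 0 ≤ B := (abs_nonneg _).trans (hB 0)
  set D := ∫ u, |(|u| ^ 1 * K u ^ 2)| with hD
  have hD0 : 0 ≤ D := integral_nonneg fun _ => abs_nonneg _
  set L := ∫ x, |f₁ x| with hL
  have hL0 : 0 ≤ L := integral_nonneg fun _ => abs_nonneg _
  set N := ∫ x, |f x| with hN
  have hN0 : 0 ≤ N := integral_nonneg fun _ => abs_nonneg _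
  set D₀ := ∫ u, |(|u| ^ 0 * K u)| with hD₀
  have hD₀0 : 0 ≤ D₀ := integral_nonneg fun _ => abs_nonneg _
  refine ⟨L * D + B * (N * D₀), by positivity, fun h hh => ?_⟩
  obtain ⟨i1, b1⟩ := integral_abs_integral_mul_comp_le (Q := fun u => K u ^ 2)
    (hK.measurable.pow_const 2) (F := fun x v => f (x - v) - f x)
    (Continuous.measurable (by fun_prop)) hL0 (k := 1)
    (fun v => (lintegral_remainder_one_le hd hf₁c v).trans_eq (by
      rw [hL]; congr 1; exact (ofReal_integral_norm_eq_lintegral_enorm hf₁i).symm)) hKw hh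
  obtain ⟨i2, b2⟩ := integral_abs_integral_mul_comp_le hK.measurable (F := fun x v => f (x - v))
    (Continuous.measurable (by fun_prop)) hN0 (k := 0)
    (fun v => by
      rw [lintegral_sub_right_eq_self (fun x => ‖f x‖ₑ), pow_zero, mul_one, hN]
      exact (ofReal_integral_norm_eq_lintegral_enorm hfi).ge) (by simpa using hK.integrable) hh
  have hm : ∀ x, |∫ u, K u * f (x - h * u)| ≤ B := fun x => by
    have := norm_integral_le_of_norm_le (μ := volume) (f := fun u => K u * f (x - h * u))
      (hK.integrable.const_mul B) (ae_of_all _ fun u => by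
        rw [norm_mul, Real.norm_of_nonneg (hK.nonneg u), mul_comm]
        exact mul_le_mul_of_nonneg_right (hB _) (hK.nonneg u))
    rwa [integral_const_mul, hK.integral_eq_one, mul_one] at this
  -- In the first term the first-order remainder supplies a factor `h` that cancels `h⁻¹`. In the
  -- squared mean, one factor is bounded by `B` and the other is bounded in `L¹`.
  have e : ∀ x, h⁻¹ * (∫ u, K u ^ 2 * f (x - h * u)) - (∫ u, K u * f (x - h * u)) ^ 2
      - h⁻¹ * R K * f x = h⁻¹ * (∫ u, K u ^ 2 * (f (x - h * u) - f x))
        - (∫ u, K u * f (x - h * u)) * ∫ u, K u * f (x - h * u) := fun x => by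
    have : ∀ u, K u ^ 2 * (f (x - h * u) - f x) = K u ^ 2 * f (x - h * u) - K u ^ 2 * f x :=
      fun u => mul_sub _ _ _
    simp_rw [this]
    rw [integral_sub (integrable_mul_comp_sub hRK hfc.measurable hB h x) (hRK.mul_const _),
      integral_mul_const, R]
    ring
  simp_rw [e]
  have i3 : Integrable fun x => (∫ u, K u * f (x - h * u)) * ∫ u, K u * f (x - h * u) :=
    i2.bdd_mul (c := B) i2.1 (ae_of_all _ hm)
  have i4 := i1.const_mul h⁻¹
  refine ⟨i4.sub i3, ?_⟩
  calc _ ≤ ∫ x, (h⁻¹ * |∫ u, K u ^ 2 * (f (x - h * u) - f x)|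
        + B * |∫ u, K u * f (x - h * u)|) := by
        refine integral_mono (i4.sub i3).abs ((i1.abs.const_mul _).add (i2.abs.const_mul _))
          fun x => ?_
        refine (abs_sub _ _).trans ?_
        rw [abs_mul, abs_of_pos (inv_pos.2 hh), abs_mul]
        gcongr
        exact hm x
    _ ≤ h⁻¹ * (L * h ^ 1 * D) + B * (N * h ^ 0 * D₀) := by
        rw [integral_add (i1.abs.const_mul _) (i2.abs.const_mul _), integral_const_mul,
          integral_const_mul]
        gcongr
    _ = _ := by
        field_simp

/-- The integrated squared bias is `h ^ 4 / 4 * μ₂ ^ 2 * R(f'')` up to `O(h ^ 5)`. -/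
lemma integral_abs_sq_bias_sub_le (hK : IsSymmetricDensity K)
    (hK1 : Integrable fun t => |t| ^ 1 * K t) (hK3 : Integrable fun t => |t| ^ 3 * K t)
    {f₁ f₂ f₃ : ℝ → ℝ} (hf₃i : Integrable f₃) (hfc : Continuous f) (hf₁c : Continuous f₁)
    (hf₂c : Continuous f₂) (hf₃c : Continuous f₃) (hd : ∀ x, HasDerivAt f (f₁ x) x)
    (hd₁ : ∀ x, HasDerivAt f₁ (f₂ x) x) (hd₂ : ∀ x, HasDerivAt f₂ (f₃ x) x)
    (hB : ∀ x, |f x| ≤ B) {B₂ : ℝ} (hB₂ : ∀ x, |f₂ x| ≤ B₂) :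
    ∃ C, 0 ≤ C ∧ ∀ h : ℝ, 0 < h →
      Integrable (fun x => ((∫ u, K u * f (x - h * u)) - f x) ^ 2
        - h ^ 4 / 4 * secondMoment K ^ 2 * f₂ x ^ 2) ∧
      ∫ x, |((∫ u, K u * f (x - h * u)) - f x) ^ 2
        - h ^ 4 / 4 * secondMoment K ^ 2 * f₂ x ^ 2| ≤ C * h ^ 5 := by
  have hB0 : 0 ≤ B₂ := (abs_nonneg _).trans (hB₂ 0)
  have hμ : 0 ≤ secondMoment K := integral_nonneg fun u => mul_nonneg (sq_nonneg _) (hK.nonneg u)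
  set D := ∫ u, |(|u| ^ 3 * K u)| with hD
  have hD0 : 0 ≤ D := integral_nonneg fun _ => abs_nonneg _
  set L := ∫ x, |f₃ x| with hL
  have hL0 : 0 ≤ L := integral_nonneg fun _ => abs_nonneg _
  refine ⟨3 * secondMoment K * B₂ * (L * D), by positivity, fun h hh => ?_⟩
  obtain ⟨i1, b1⟩ := integral_abs_integral_mul_comp_le hK.measurable
    (F := fun x v => f (x - v) - f x + v * f₁ x - v ^ 2 / 2 * f₂ x)
    (Continuous.measurable (by fun_prop)) hL0 (k := 3)
    (fun v => (lintegral_remainder_three_le hd hd₁ hd₂ hf₁c hf₂c hf₃c v).trans_eq (by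
      rw [hL]; congr 1; exact (ofReal_integral_norm_eq_lintegral_enorm hf₃i).symm)) hK3 hh
  have hKi : Integrable fun u => u * K u := by
    refine hK1.mono (measurable_id.mul hK.measurable).aestronglyMeasurable (ae_of_all _ fun u => ?_)
    simp
  have hbias := bias_eq (g₁ := f₁) (g₂ := f₂) hK.integrable hK.integral_eq_one hK.mean_zero hKi
    hK.finite_variance hfc.measurable hB h
  have hbd := abs_bias_remainder_le hK.nonneg hK.finite_variance hd hd₁ hf₁c hf₂c hB₂ h
  set E : ℝ → ℝ := fun x => ∫ u, K u * (f (x - h * u) - f x + (h * u) * f₁ x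
    - (h * u) ^ 2 / 2 * f₂ x) with hE
  -- With bias `b + E`, the difference `(b + E)² - b²` factors as `(2 b + E) E`: the first factor is
  -- `O(h²)` uniformly, the second `O(h³)` in `L¹`.
  have e : ∀ x, ((∫ u, K u * f (x - h * u)) - f x) ^ 2
        - h ^ 4 / 4 * secondMoment K ^ 2 * f₂ x ^ 2
      = (h ^ 2 * secondMoment K * f₂ x + E x) * E x := fun x => by
    rw [hbias]
    ring
  have hb : ∀ x, |h ^ 2 * secondMoment K * f₂ x + E x| ≤ 3 * secondMoment K * B₂ * h ^ 2 :=
    fun x => by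
      refine (abs_add_le _ _).trans ?_
      have h1 : |h ^ 2 * secondMoment K * f₂ x| ≤ h ^ 2 * secondMoment K * B₂ := by
        rw [abs_mul, abs_of_nonneg (by positivity)]
        gcongr
        exact hB₂ x
      have h2 : |E x| ≤ _ := hbd x
      linarith
  simp_rw [e]
  have i2 : Integrable fun x => (h ^ 2 * secondMoment K * f₂ x + E x) * E x :=
    i1.bdd_mul (c := 3 * secondMoment K * B₂ * h ^ 2)
      ((hf₂c.measurable.const_mul _).aestronglyMeasurable.add i1.1) (ae_of_all _ hb)
  refine ⟨i2, ?_⟩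
  calc _ ≤ ∫ x, 3 * secondMoment K * B₂ * h ^ 2 * |E x| := by
        refine integral_mono i2.abs (i1.abs.const_mul _) fun x => ?_
        simp only [abs_mul]
        gcongr
        simpa only [abs_mul] using hb x
    _ ≤ 3 * secondMoment K * B₂ * h ^ 2 * (L * h ^ 3 * D) := by
        rw [integral_const_mul]
        gcongr
    _ = _ := by ring

end Deterministic

end MarkovKDE

/-! ### Assembly of the expansion. -/

theorem corollary2
    (K f : ℝ → ℝ) (S : Set ℝ) (hS : MeasurableSet S)
    (hcond : ∀ r ∈ ({1, 2, 3} : Set ℕ), MarkovKDE.RegularityConditions K f r)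
    (hRK : Integrable (fun t => K t ^ 2))
    (hf : MarkovKDE.IsDensityOn f S)
    (P : Kernel S S) [IsMarkovKernel P]
    (hgeo : MarkovKDE.GeometricallyErgodic P (MarkovKDE.densityMeasure f S))
    (hrev : P.IsReversible (MarkovKDE.densityMeasure f S))
    {Ω : Type*} [MeasurableSpace Ω] (μ : Measure Ω) [IsProbabilityMeasure μ]
    (Y : ℕ → Ω → S)
    (hY : MarkovKDE.IsMarkovChain μ Y P (MarkovKDE.densityMeasure f S)) :
    -- all the integrals in the two error criteria are finite
    (∀ (n : ℕ) (h : ℝ), 1 ≤ n → 0 < h →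
      Integrable (fun p : ℝ × Ω =>
          (MarkovKDE.kde K (fun i ω => (Y i ω : ℝ)) n h p.1 p.2 - f p.1) ^ 2) (volume.prod μ) ∧
      Integrable (fun x => MarkovKDE.tau μ K (fun i ω => (Y i ω : ℝ)) n h x * f x)) ∧
    Integrable (fun x => iteratedDeriv 2 f x ^ 2) ∧
    -- the expansion, for every sequence of bandwidths tending to zero
    ∀ h : ℕ → ℝ, (∀ n, 0 < h n) → Tendsto h atTop (𝓝 0) →
      (fun n : ℕ => MarkovKDE.mise μ K f (fun i ω => (Y i ω : ℝ)) n (h n)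
          - MarkovKDE.mamise μ K f (fun i ω => (Y i ω : ℝ)) n (h n))
        =O[atTop] fun n : ℕ => (n : ℝ)⁻¹ + h n ^ 5 := by
  open MarkovKDE in
  have c1 := hcond 1 (by simp)
  have c2 := hcond 2 (by simp)
  have c3 := hcond 3 (by simp)
  have hK := c1.kernel
  have hC3 := c3.contDiff
  have hd : ∀ x, HasDerivAt f (iteratedDeriv 1 f x) x := by
    simpa using hasDerivAt_iteratedDeriv hC3 (k := 0) (by norm_num)
  have hd₁ := hasDerivAt_iteratedDeriv hC3 (k := 1) (by norm_num)
  have hd₂ := hasDerivAt_iteratedDeriv hC3 (k := 2) (by norm_num)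
  have hfc := hC3.continuous
  have hf₁c := hC3.continuous_iteratedDeriv 1 (by norm_num)
  have hf₂c := hC3.continuous_iteratedDeriv 2 (by norm_num)
  have hf₃c := hC3.continuous_iteratedDeriv 3 (by norm_num)
  have hfi := hf.integrable
  -- `f` and `f''` are bounded because `f'` and `f'''` are integrable. With their own integrability
  -- this also gives the square integrability of both.
  obtain ⟨B, hB0, hB⟩ := exists_bound_of_integrable_deriv hd hf₁c c1.integrable_deriv
  obtain ⟨B₂, hB₂0, hB₂⟩ := exists_bound_of_integrable_deriv hd₂ hf₃c c3.integrable_deriv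
  have hYm : ∀ i, Measurable fun ω => (Y i ω : ℝ) := fun i =>
    measurable_subtype_coe.comp (hY.measurable i)
  have hg2 : ∀ h, 0 < h → ∀ x, MemLp (fun y : S => scaled K h (x - y)) 2 (densityMeasure f S) :=
    fun h hh x => memLp_scaled_densityMeasure hS hfc.measurable hf hB hK.measurable hRK hh x
  obtain ⟨T, hT0, hT⟩ := hY.abs_tau_le hgeo hrev hK.measurable
  have hτm := fun n h => measurable_tau (μ := μ) hK.measurable hYm n h
  have hff : Integrable fun x => f x ^ 2 := by
    simp_rw [sq]
    exact hfi.bdd_mul (c := B) hfi.1 (ae_of_all _ hB)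
  have hτf : ∀ (n : ℕ) (h : ℝ), 0 < h →
      Integrable fun x => tau μ K (fun i ω => (Y i ω : ℝ)) n h x * f x := fun n h hh =>
    hfi.bdd_mul (c := T) (hτm n h).aestronglyMeasurable (ae_of_all _ fun x => hT n h x (hg2 h hh x))
  have hf₂2 : Integrable fun x => iteratedDeriv 2 f x ^ 2 := by
    simp_rw [sq]
    exact c2.integrable_deriv.bdd_mul (c := B₂) c2.integrable_deriv.1 (ae_of_all _ hB₂)
  refine ⟨fun n h _ hh => ⟨?_, hτf n h hh⟩, hf₂2, fun h hpos _ => ?_⟩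
  · have hfL : MemLp (fun p : ℝ × Ω => f p.1) 2 (volume.prod μ) := by
      refine (memLp_two_iff_integrable_sq ?_).2 (hff.comp_fst μ)
      exact (hfc.measurable.comp measurable_fst).aestronglyMeasurable
    exact ((memLp_uncurry_kde hK.measurable hRK hYm n hh).sub hfL).integrable_sq
  obtain ⟨C₁, hC₁0, hvar⟩ := integral_abs_variance_remainder_le hK hRK
    (integrable_abs_mul_sq hK.measurable hK.nonneg hK.integrable hRK c1.tail) hfi
    c1.integrable_deriv hfc hf₁c hd hB
  obtain ⟨C₂, hC₂0, hbias⟩ := integral_abs_sq_bias_sub_le hK c1.moment c3.moment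
    c3.integrable_deriv hfc hf₁c hf₂c hf₃c hd hd₁ hd₂ hB hB₂
  refine IsBigO.of_bound (T * C₁ + C₂) ?_
  filter_upwards [eventually_ge_atTop 1] with n hn
  have hh := hpos n
  set a := h n
  obtain ⟨i1, b1⟩ := hvar a hh
  obtain ⟨i2, b2⟩ := hbias a hh
  set τ := tau μ K (fun i ω => (Y i ω : ℝ)) n a with hτ
  have hτT : ∀ x, |τ x| ≤ T := fun x => hT n a x (hg2 a hh x)
  set A : ℝ → ℝ := fun x => a⁻¹ * (∫ u, K u ^ 2 * f (x - a * u))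
    - (∫ u, K u * f (x - a * u)) ^ 2 - a⁻¹ * R K * f x with hA
  set Q : ℝ → ℝ := fun x => ((∫ u, K u * f (x - a * u)) - f x) ^ 2
    - a ^ 4 / 4 * secondMoment K ^ 2 * iteratedDeriv 2 f x ^ 2 with hQ
  have i3 : Integrable fun x => τ x * A x :=
    i1.bdd_mul (c := T) (hτm n a).aestronglyMeasurable (ae_of_all _ hτT)
  have hn0 : (0 : ℝ) < n := by exact_mod_cast hn
  -- An exact identity: the leading parts of variance and squared bias integrate to mAMISE, so only
  -- the two remainders are left to estimate.
  have hmise : mise μ K f (fun i ω => (Y i ω : ℝ)) n a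
      = (1 / n * ∫ x, τ x * A x) + (∫ x, Q x) + mamise μ K f (fun i ω => (Y i ω : ℝ)) n a := by
    have e : ∀ x, ∫ ω, (kde K (fun i ω => (Y i ω : ℝ)) n a x ω - f x) ^ 2 ∂μ
        = ((1 / n * (τ x * A x) + Q x) + 1 / (n * a) * R K * (τ x * f x))
          + a ^ 4 / 4 * secondMoment K ^ 2 * iteratedDeriv 2 f x ^ 2 := fun x => by
      rw [integral_kde_sub_sq hS hfc.measurable hf hB hK.measurable hRK hgeo hrev hY hn hh]
      simp only [hA, hQ]
      rw [one_div_mul_eq_div, one_div_mul_eq_div, ← hτ]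
      field_simp
      ring
    rw [mise]
    simp_rw [e]
    have j1 := i3.const_mul (1 / (n : ℝ))
    have j2 := (hτf n a hh).const_mul (1 / (n * a) * R K)
    have j3 := hf₂2.const_mul (a ^ 4 / 4 * secondMoment K ^ 2)
    rw [integral_add (by exact (j1.add i2).add j2) j3, integral_add (by exact j1.add i2) j2,
      integral_add j1 i2, integral_const_mul, integral_const_mul, integral_const_mul, mamise, zeta,
      show R (iteratedDeriv 2 f) = ∫ x, iteratedDeriv 2 f x ^ 2 from rfl]
    ring
  have hb3 : |∫ x, τ x * A x| ≤ T * C₁ := by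
    refine (abs_integral_le_integral_abs).trans ?_
    calc ∫ x, |τ x * A x| ≤ ∫ x, T * |A x| := by
          refine integral_mono i3.abs (i1.abs.const_mul T) fun x => ?_
          simp only [abs_mul]
          exact mul_le_mul_of_nonneg_right (hτT x) (abs_nonneg _)
      _ ≤ T * C₁ := by
          rw [integral_const_mul]
          gcongr
  have hb2 : |∫ x, Q x| ≤ C₂ * a ^ 5 := abs_integral_le_integral_abs.trans b2
  rw [hmise, add_sub_cancel_right, Real.norm_eq_abs, Real.norm_of_nonneg (by positivity)]
  refine (abs_add_le _ _).trans ?_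
  rw [abs_mul, abs_of_pos (by positivity), one_div]
  have h1 : (n : ℝ)⁻¹ * |∫ x, τ x * A x| ≤ (n : ℝ)⁻¹ * (T * C₁) := by gcongr
  -- The nonnegative cross terms complete `T C₁ n⁻¹ + C₂ a⁵` to the product `(T C₁ + C₂)(n⁻¹ + a⁵)`.
  have h2 : 0 ≤ T * C₁ * a ^ 5 := by positivity
  have h3 : 0 ≤ C₂ * (n : ℝ)⁻¹ := by positivity
  linarith
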